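/- All graphs are finite, undirected and simple. For a graph $G=(V,E)$ let $\mathscr T_G$ be the set of triangles of $G$, each triangle being identified with its edge set. A \emph{triangle cover} of $G$ is a set $S\subseteq E$ that intersects every triangle of $G$; $\tau_t(G)$ is the minimum cardinality of a triangle cover. A \emph{triangle packing} is a set of pairwise edge-disjoint triangles of $G$; $\nu_t(G)$ is the maximum cardinality of a triangle packing. $G$ is \emph{irreducible} if every edge of $G$ lies in a triangle of $G$. Theorem. Consider the irreducible graphs $G=(V,E)$ that satisfy at least one of the conditions (i) $\nu_t(G)\ge\frac13|\mathscr T_G|$, (ii) $\nu_t(G)\ge\frac14|E|$, (iii) $|E|\ge 2|\mathscr T_G|$. There is a polynomial-time algorithm that, given any such graph $G$, finds a triangle cover of $G$ of cardinality at most $2\nu_t(G)$. More precisely, there are a program $A$ for a random access machine (natural-number registers and indirectly addressed arrays, with addition and truncated subtraction, one time unit per operation) and a polynomial $p$ such that, on the adjacency matrix of any such graph $G$ with $n$ vertices, $A$ halts after at most $p(n)$ time units and outputs the matrix of a triangle cover of $G$ of cardinality at most $2\nu_t(G)$. Consequently $\tau_t(G)\le2\nu_t(G)$ for every such $G$, that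 is, Tuza's conjecture holds for $G$. -/

import Mathlib

namespace Tuza

/-! ## Triangles, packings and covers -/

section Graphs

variable {V : Type*}

/-- The set of triangles of `G`, each triangle being identified with its edge set. -/
def triangles (G : SimpleGraph V) : Set (Set (Sym2 V)) :=
  {T | ∃ a b c : V, G.Adj a b ∧ G.Adj b c ∧ G.Adj a c ∧ T = {s(a, b), s(b, c), s(a, c)}}

/-- A graph is irreducible if every edge lies in a triangle. -/
def IsIrreducible (G : SimpleGraph V) : Prop :=
  ∀ e ∈ G.edgeSet, ∃ T ∈ triangles G, e ∈ T

/-- A set of edges of `G` that intersects every triangle of `G`. -/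
def IsTriangleCover (G : SimpleGraph V) (S : Set (Sym2 V)) : Prop :=
  S ⊆ G.edgeSet ∧ ∀ T ∈ triangles G, (S ∩ T).Nonempty

/-- A set of pairwise edge-disjoint triangles of `G`. -/
def IsTrianglePacking (G : SimpleGraph V) (P : Set (Set (Sym2 V))) : Prop :=
  P ⊆ triangles G ∧ P.PairwiseDisjoint id

/-- The triangle packing number `ν_t(G)` of a finite graph. -/
noncomputable def packingNumber (G : SimpleGraph V) : ℕ :=
  sSup {k | ∃ P, IsTrianglePacking G P ∧ P.ncard = k}

/-- The triangle covering number `τ_t(G)` of a finite graph. -/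
noncomputable def coveringNumber (G : SimpleGraph V) : ℕ :=
  sInf {k | ∃ S, IsTriangleCover G S ∧ S.ncard = k}

end Graphs

/-! ## A random access machine with a step count

Programs work on natural-number registers and on arrays of natural numbers. A program names finitely
many registers and arrays; array cells are addressed indirectly. The arithmetic operations are
addition and truncated subtraction only (no multiplication), so that charging one time unit
for every operation is, up to a polynomial, the same as Turing machine time. -/

/-- The contents of the registers and of the arrays. -/
structure State where
  reg : ℕ → ℕ
  arr : ℕ → ℕ → ℕ

/-- Expressions: a constant, the content of a register, a cell of an array, a sum,
a truncated difference. -/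
inductive Term : Type
  | const (c : ℕ)
  | reg (x : ℕ)
  | read (a : ℕ) (i : Term)
  | add (e f : Term)
  | sub (e f : Term)

/-- The value of an expression. -/
def Term.eval (s : State) : Term → ℕ
  | .const c => c
  | .reg x => s.reg x
  | .read a i => s.arr a (i.eval s)
  | .add e f => e.eval s + f.eval s
  | .sub e f => e.eval s - f.eval s

/-- The time it takes to evaluate an expression: one unit per operation. -/
def Term.cost : Term → ℕ
  | .const _ => 1
  | .reg _ => 1
  | .read _ i => i.cost + 1
  | .add e f => e.cost + f.cost + 1
  | .sub e f => e.cost + f.cost + 1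

/-- Programs. Tests are of the form "the value of `e` is not zero". -/
inductive Program : Type
  | skip
  | assign (x : ℕ) (e : Term)
  | write (a : ℕ) (i e : Term)
  | seq (p q : Program)
  | ite (e : Term) (p q : Program)
  | while (e : Term) (p : Program)

/-- The state after register `x` received the value `v`. -/
def State.setReg (s : State) (x v : ℕ) : State :=
  { s with reg := Function.update s.reg x v }

/-- The state after cell `i` of array `a` received the value `v`. -/
def State.setArr (s : State) (a i v : ℕ) : State :=
  { s with arr := Function.update s.arr a (Function.update (s.arr a) i v) }

/-- `Runs p s t s'`: started in the state `s`, the program `p` halts after exactly `t` time units,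
in the state `s'`. -/
inductive Runs : Program → State → ℕ → State → Prop
  | skip (s : State) : Runs .skip s 1 s
  | assign (s : State) (x : ℕ) (e : Term) :
      Runs (.assign x e) s (e.cost + 1) (s.setReg x (e.eval s))
  | write (s : State) (a : ℕ) (i e : Term) :
      Runs (.write a i e) s (i.cost + e.cost + 1) (s.setArr a (i.eval s) (e.eval s))
  | seq {p q : Program} {s s' s'' : State} {t t' : ℕ} :
      Runs p s t s' → Runs q s' t' s'' → Runs (.seq p q) s (t + t') s''
  | ite_true {e : Term} {p q : Program} {s s' : State} {t : ℕ} :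
      e.eval s ≠ 0 → Runs p s t s' → Runs (.ite e p q) s (e.cost + 1 + t) s'
  | ite_false {e : Term} {p q : Program} {s s' : State} {t : ℕ} :
      e.eval s = 0 → Runs q s t s' → Runs (.ite e p q) s (e.cost + 1 + t) s'
  | while_true {e : Term} {p : Program} {s s' s'' : State} {t t' : ℕ} :
      e.eval s ≠ 0 → Runs p s t s' → Runs (.while e p) s' t' s'' →
      Runs (.while e p) s (e.cost + 1 + t + t') s''
  | while_false {e : Term} {p : Program} {s : State} :
      e.eval s = 0 → Runs (.while e p) s (e.cost + 1) s

/-- Programs are deterministic: the running time and the final state are determined by the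
program and the initial state. -/
theorem Runs.deterministic {p : Program} {s s₁ s₂ : State} {t₁ t₂ : ℕ}
    (h₁ : Runs p s t₁ s₁) (h₂ : Runs p s t₂ s₂) : t₁ = t₂ ∧ s₁ = s₂ := by
  induction h₁ generalizing t₂ s₂ with
  | skip => cases h₂; exact ⟨rfl, rfl⟩
  | assign => cases h₂; exact ⟨rfl, rfl⟩
  | write => cases h₂; exact ⟨rfl, rfl⟩
  | seq _ _ ih ih' =>
    cases h₂ with
    | seq k k' =>
      obtain ⟨rfl, rfl⟩ := ih k
      obtain ⟨rfl, rfl⟩ := ih' k'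
      exact ⟨rfl, rfl⟩
  | ite_true h _ ih =>
    cases h₂ with
    | ite_true _ k => obtain ⟨rfl, rfl⟩ := ih k; exact ⟨rfl, rfl⟩
    | ite_false k _ => exact absurd k h
  | ite_false h _ ih =>
    cases h₂ with
    | ite_true k _ => exact absurd h k
    | ite_false _ k => obtain ⟨rfl, rfl⟩ := ih k; exact ⟨rfl, rfl⟩
  | while_true h _ _ ih ih' =>
    cases h₂ with
    | while_true _ k k' =>
      obtain ⟨rfl, rfl⟩ := ih k
      obtain ⟨rfl, rfl⟩ := ih' k'
      exact ⟨rfl, rfl⟩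
    | while_false k => exact absurd k h
  | while_false h =>
    cases h₂ with
    | while_true k _ _ => exact absurd h k
    | while_false _ => exact ⟨rfl, rfl⟩

open Classical in
/-- The `n × n` zero-one matrix, stored row by row, of a set of edges on `n` vertices;
all further entries are zero. For `S = E(G)` this is the adjacency matrix of `G`. -/
noncomputable def edgeMatrix (n : ℕ) (S : Set (Sym2 (Fin n))) (k : ℕ) : ℕ :=
  if ∃ i j : Fin n, k = i.val * n + j.val ∧ s(i, j) ∈ S then 1 else 0

/-- The initial state on input `G`: register `0` holds the number of vertices, array `0` holds the
adjacency matrix, and everything else is zero. -/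
noncomputable def inputState {n : ℕ} (G : SimpleGraph (Fin n)) : State where
  reg x := if x = 0 then n else 0
  arr a k := if a = 0 then edgeMatrix n G.edgeSet k else 0

/-- In the state `s`, the first `n * n` cells of array `1` hold the matrix of the edge set `S`. -/
def HasOutput {n : ℕ} (s : State) (S : Set (Sym2 (Fin n))) : Prop :=
  ∀ k < n * n, s.arr 1 k = edgeMatrix n S k

end Tuza

/-!
If there are at most `3 ν` triangles, or at most half as many triangles as edges, a cover is found
by deleting edges greedily until no triangle is left; if there are at most `4 ν` edges, by a cut.
Here `ν` is the packing number.

*The greedy rule.* A triangle is a leaf if at most one of its edges lies in another triangle; this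
edge (any edge, if there is none) is its center. The rule deletes the center of a leaf if there is
one, else an edge in at least three triangles, else an edge in two triangles whose deletion
creates a leaf, else any edge in two triangles (`prio`, `GreedyRun`). Write `m` for the number of
triangles and `N` for the number of edges in triangles. By induction over the run, the set `S` of
deleted edges satisfies two inequalities.

* `|S| + N ≤ 2 ν + 2 m` (`GreedyRun.ncard_add_le`). Let the deleted edge `e` lie in `d` triangles.
  If it is the center of a leaf, `ν` drops and `N` drops by at most `1 + 2 d`. Otherwise `d ≥ 2`,
  and `N` drops by at most `1 + d`. For an irreducible graph `N = |E|`, so that `|S| ≤ 2 ν` if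
  `2 m ≤ |E|`.
* `3 |S| ≤ 3 ν + m` (`GreedyRun.three_mul_ncard_le`), so that `|S| ≤ 2 ν` if `m ≤ 3 ν`. Only an
  edge in exactly two triangles is not paid for by the drop of `ν` or `m`: it leaves a deficit of `1`.
  If its deletion creates a leaf, then the next deletion has a gain of at least `1`, and of at
  least `2` if moreover no triangle is isolated. If no deletion creates a leaf, then there is no
  `K₄` (`HasK4.canCreateLeaf`), and every edge of a triangle lies in two triangles
  (`canCreateLeaf_of_codeg_eq_one`). After one deletion another one does create a leaf, and
  without `K₄` no triangle becomes isolated (`not_isolated_del`); the gain from the leaf pays for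
  both deletions.

*The cut.* If each vertex in turn is put on the side where it has fewer neighbours so far, then at
most half of the edges have both ends on the same side. These edges cover all triangles, and there
are at most `2 ν` of them if `|E| ≤ 4 ν` (`two_mul_ncard_monoEdges_le`).

*The machine.* The quantities and predicates that a program of the machine evaluates in polynomial
time without changing the arrays (`Comp`, `CompP`) are closed under arithmetic, array access,
bounded sums, bounded quantifiers and bounded search; the transformations of the arrays that can
be carried out in polynomial time (`Exec`) are closed under composition, local variables and loops
over the numbers below `n`. The algorithm `tuzaM` is written in these terms, so that a program
with a polynomial time bound exists by `exec_tuzaM`, and `tuzaM_spec` identifies its output with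
the smaller one of the two covers.
-/

namespace Tuza

/-! ### Computing with the machine -/

section Machine

/-- The contents of all arrays. -/
abbrev Mem := ℕ → ℕ → ℕ

/-- A context is a type of tuples of local variables. `Holds ℓ ρ a` says that the register contents
`ρ` store the tuple `a`, its `k`-th entry (counted from the most recent one) in register `ℓ k`. -/
class Context (α : Type) where
  Holds : (ℕ → ℕ) → (ℕ → ℕ) → α → Prop
  congr : ∀ {ℓ ρ ρ' : ℕ → ℕ} {a : α}, (∀ k, ρ' (ℓ k) = ρ (ℓ k)) → Holds ℓ ρ a → Holds ℓ ρ' a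

instance : Context Unit where
  Holds _ _ _ := True
  congr _ _ := trivial

instance {α : Type} [Context α] : Context (α × ℕ) where
  Holds ℓ ρ p := ρ (ℓ 0) = p.2 ∧ Context.Holds (fun k => ℓ (k + 1)) ρ p.1
  congr h := fun ⟨h₀, h₁⟩ => ⟨(h 0).trans h₀, Context.congr (fun k => h (k + 1)) h₁⟩

/-- `Comp f`: the quantity `f n m a`, depending on the size `n`, the arrays `m` and the local
variables `a`, can be computed in polynomial time. The program must exist for every free register
`r` above the registers of the local variables; it leaves the result in register `r`, and changes
neither the arrays nor the registers below `r`. -/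
def Comp {α : Type} [Context α] (f : ℕ → Mem → α → ℕ) : Prop :=
  ∃ P : Polynomial ℕ, ∀ (r : ℕ) (ℓ : ℕ → ℕ), 0 < r → (∀ k, ℓ k < r) → ∃ p : Program,
    ∀ (s : State) (a : α), Context.Holds ℓ s.reg a → ∃ t s', Runs p s t s' ∧
      t ≤ P.eval (s.reg 0) ∧ (∀ x < r, s'.reg x = s.reg x) ∧ s'.arr = s.arr ∧
      s'.reg r = f (s.reg 0) s.arr a

/-- `Exec F`: the transformation `F n · a` of the arrays can be carried out in polynomial time.
The registers below the free register `r` are left unchanged. -/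
def Exec {α : Type} [Context α] (F : ℕ → Mem → α → Mem) : Prop :=
  ∃ P : Polynomial ℕ, ∀ (r : ℕ) (ℓ : ℕ → ℕ), 0 < r → (∀ k, ℓ k < r) → ∃ p : Program,
    ∀ (s : State) (a : α), Context.Holds ℓ s.reg a → ∃ t s', Runs p s t s' ∧
      t ≤ P.eval (s.reg 0) ∧ (∀ x < r, s'.reg x = s.reg x) ∧ s'.arr = F (s.reg 0) s.arr a

/-- The indicator of a proposition. -/
noncomputable def ind (p : Prop) : ℕ := open Classical in if p then 1 else 0

theorem ind_pos {p : Prop} (h : p) : ind p = 1 := if_pos h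
theorem ind_neg {p : Prop} (h : ¬p) : ind p = 0 := if_neg h
theorem ind_ne_zero {p : Prop} : ind p ≠ 0 ↔ p := by
  unfold ind; split_ifs with h <;> simp [h]

/-- The predicate `Q` can be decided in polynomial time. -/
def CompP {α : Type} [Context α] (Q : ℕ → Mem → α → Prop) : Prop :=
  Comp fun n m a => ind (Q n m a)

/-- The counter of a loop runs from its present value to the size `n`; the running time is at most
`T + 8` for each round. -/
theorem runs_while {p : Program} {c n T : ℕ} {J : ℕ → State → Prop}
    (hJ : ∀ i s, J i s → s.reg 0 = n ∧ s.reg c = i)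
    (hp : ∀ i s, i < n → J i s →
      ∃ t s', Runs p s t s' ∧ t ≤ T ∧ J (i + 1) (s'.setReg c (s'.reg c + 1)))
    (k : ℕ) : ∀ (i : ℕ) (s : State), i + k = n → J i s →
      ∃ t s', Runs (.while (.sub (.reg 0) (.reg c)) (.seq p (.assign c (.add (.reg c) (.const 1)))))
        s t s' ∧ t ≤ k * (T + 8) + 4 ∧ J n s' := by
  induction k with
  | zero =>
    intro i s hi hs
    obtain ⟨h0, hc⟩ := hJ i s hs
    refine ⟨_, s, Runs.while_false ?_, ?_, ?_⟩
    · simp only [Term.eval]; omega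
    · simp [Term.cost]
    · obtain rfl : i = n := by omega
      exact hs
  | succ k ih =>
    intro i s hi hs
    obtain ⟨h0, hc⟩ := hJ i s hs
    obtain ⟨t, s', hr, ht, hJ'⟩ := hp i s (by omega) hs
    obtain ⟨t', s'', hr', ht', hJ''⟩ := ih (i + 1) _ (by omega) hJ'
    refine ⟨_, s'', Runs.while_true ?_ (Runs.seq hr (Runs.assign s' c _)) hr', ?_, hJ''⟩
    · simp only [Term.eval]; omega
    · simp only [Term.cost]
      have : (k + 1) * (T + 8) = k * (T + 8) + (T + 8) := by ring
      omega

theorem State.reg_setReg_self (s : State) (x v : ℕ) : (s.setReg x v).reg x = v := by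
  simp [State.setReg]

theorem State.reg_setReg_of_ne (s : State) {x y : ℕ} (v : ℕ) (h : y ≠ x) :
    (s.setReg x v).reg y = s.reg y := by
  simp [State.setReg, h]

theorem State.arr_setReg (s : State) (x v : ℕ) : (s.setReg x v).arr = s.arr := rfl

variable {α : Type} [Context α]

namespace Comp

theorem const (c : ℕ) : Comp fun _ _ (_ : α) => c :=
  ⟨2, fun r _ _ _ => ⟨.assign r (.const c), fun s _ _ =>
    ⟨_, _, Runs.assign _ _ _, by simp [Term.cost], fun x hx => s.reg_setReg_of_ne _ hx.ne, rfl,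
      by rw [State.reg_setReg_self]; rfl⟩⟩⟩

theorem size : Comp fun n _ (_ : α) => n :=
  ⟨2, fun r _ _ _ => ⟨.assign r (.reg 0), fun s _ _ =>
    ⟨_, _, Runs.assign _ _ _, by simp [Term.cost], fun x hx => s.reg_setReg_of_ne _ hx.ne, rfl,
      by rw [State.reg_setReg_self]; rfl⟩⟩⟩

theorem var : Comp fun _ _ (p : α × ℕ) => p.2 :=
  ⟨2, fun r ℓ _ _ => ⟨.assign r (.reg (ℓ 0)), fun s _ h =>
    ⟨_, _, Runs.assign _ _ _, by simp [Term.cost], fun x hx => s.reg_setReg_of_ne _ hx.ne, rfl,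
      by rw [State.reg_setReg_self]; exact h.1⟩⟩⟩

theorem weaken {f : ℕ → Mem → α → ℕ} (hf : Comp f) : Comp fun n m (p : α × ℕ) => f n m p.1 := by
  obtain ⟨P, hP⟩ := hf
  refine ⟨P, fun r ℓ hr hℓ => ?_⟩
  obtain ⟨p, hp⟩ := hP r (fun k => ℓ (k + 1)) hr fun k => hℓ _
  exact ⟨p, fun s a h => hp s a.1 h.2⟩

/-- Unary operations of the machine: `e` computes from register `r` the value `g n m (f n m a)`. -/
theorem unary {f : ℕ → Mem → α → ℕ} (hf : Comp f) (g : ℕ → Mem → ℕ → ℕ) (e : ℕ → Term) (c : ℕ)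
    (hc : ∀ r, (e r).cost = c)
    (he : ∀ (s : State) r, (e r).eval s = g (s.reg 0) s.arr (s.reg r)) :
    Comp fun n m a => g n m (f n m a) := by
  obtain ⟨P, hP⟩ := hf
  refine ⟨P + Polynomial.C (c + 1), fun r ℓ hr hℓ => ?_⟩
  obtain ⟨p, hp⟩ := hP r ℓ hr hℓ
  refine ⟨.seq p (.assign r (e r)), fun s a h => ?_⟩
  obtain ⟨t, s', h1, h2, h3, h4, h5⟩ := hp s a h
  refine ⟨_, _, Runs.seq h1 (Runs.assign _ _ _), ?_, fun x hx => ?_, h4, ?_⟩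
  · rw [hc]; simp; omega
  · rw [State.reg_setReg_of_ne _ _ hx.ne, h3 x hx]
  · rw [State.reg_setReg_self, he, h3 0 hr, h4, h5]

/-- Binary operations of the machine. -/
theorem binary {f g : ℕ → Mem → α → ℕ} (hf : Comp f) (hg : Comp g) (o : ℕ → ℕ → ℕ)
    (e : ℕ → ℕ → Term) (c : ℕ) (hc : ∀ r r', (e r r').cost = c)
    (he : ∀ (s : State) r r', (e r r').eval s = o (s.reg r) (s.reg r')) :
    Comp fun n m a => o (f n m a) (g n m a) := by
  obtain ⟨P, hP⟩ := hf
  obtain ⟨Q, hQ⟩ := hg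
  refine ⟨P + Q + Polynomial.C (c + 1), fun r ℓ hr hℓ => ?_⟩
  obtain ⟨p, hp⟩ := hP r ℓ hr hℓ
  obtain ⟨q, hq⟩ := hQ (r + 1) ℓ (by omega) fun k => (hℓ k).trans (by omega)
  refine ⟨.seq p (.seq q (.assign r (e r (r + 1)))), fun s a h => ?_⟩
  obtain ⟨t, s', h1, h2, h3, h4, h5⟩ := hp s a h
  obtain ⟨t', s'', k1, k2, k3, k4, k5⟩ := hq s' a (Context.congr (fun k => h3 _ (hℓ k)) h)
  rw [h3 0 hr] at k2 k5
  refine ⟨_, _, Runs.seq h1 (Runs.seq k1 (Runs.assign _ _ _)), ?_, fun x hx => ?_, ?_, ?_⟩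
  · rw [hc]; simp; omega
  · rw [State.reg_setReg_of_ne _ _ hx.ne, k3 x (by omega), h3 x hx]
  · rw [State.arr_setReg, k4, h4]
  · rw [State.reg_setReg_self, he, k5, k3 r (by omega), h5, h4]

theorem read {f : ℕ → Mem → α → ℕ} (b : ℕ) (hf : Comp f) : Comp fun n m a => m b (f n m a) :=
  hf.unary (fun _ m i => m b i) (fun r => .read b (.reg r)) 2 (fun _ => rfl) fun _ _ => rfl

theorem add {f g : ℕ → Mem → α → ℕ} (hf : Comp f) (hg : Comp g) :
    Comp fun n m a => f n m a + g n m a :=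
  hf.binary hg (· + ·) (fun r r' => .add (.reg r) (.reg r')) 3 (fun _ _ => rfl) fun _ _ _ => rfl

theorem sub {f g : ℕ → Mem → α → ℕ} (hf : Comp f) (hg : Comp g) :
    Comp fun n m a => f n m a - g n m a :=
  hf.binary hg (· - ·) (fun r r' => .sub (.reg r) (.reg r')) 3 (fun _ _ => rfl) fun _ _ _ => rfl

theorem ite {Q : ℕ → Mem → α → Prop} [∀ n m a, Decidable (Q n m a)] {f g : ℕ → Mem → α → ℕ}
    (hQ : CompP Q) (hf : Comp f) (hg : Comp g) :
    Comp fun n m a => if Q n m a then f n m a else g n m a := by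
  obtain ⟨P, hP⟩ := hQ
  obtain ⟨P₁, hP₁⟩ := hf
  obtain ⟨P₂, hP₂⟩ := hg
  refine ⟨P + P₁ + P₂ + 2, fun r ℓ hr hℓ => ?_⟩
  obtain ⟨p, hp⟩ := hP r ℓ hr hℓ
  obtain ⟨p₁, hp₁⟩ := hP₁ r ℓ hr hℓ
  obtain ⟨p₂, hp₂⟩ := hP₂ r ℓ hr hℓ
  refine ⟨.seq p (.ite (.reg r) p₁ p₂), fun s a h => ?_⟩
  obtain ⟨t, s', h1, h2, h3, h4, h5⟩ := hp s a h
  have h' := Context.congr (fun k => h3 _ (hℓ k)) h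
  by_cases hq : Q (s.reg 0) s.arr a
  · simp only [ind_pos hq] at h5
    obtain ⟨t', s'', k1, k2, k3, k4, k5⟩ := hp₁ s' a h'
    rw [h3 0 hr] at k2 k5
    refine ⟨_, _, Runs.seq h1 (Runs.ite_true (by simp [Term.eval, h5]) k1), ?_, fun x hx => ?_,
      k4.trans h4, ?_⟩
    · simp [Term.cost]; omega
    · rw [k3 x hx, h3 x hx]
    · simp only [k5, h4, if_pos hq]
  · simp only [ind_neg hq] at h5
    obtain ⟨t', s'', k1, k2, k3, k4, k5⟩ := hp₂ s' a h'
    rw [h3 0 hr] at k2 k5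
    refine ⟨_, _, Runs.seq h1 (Runs.ite_false (by simp [Term.eval, h5]) k1), ?_, fun x hx => ?_,
      k4.trans h4, ?_⟩
    · simp [Term.cost]; omega
    · rw [k3 x hx, h3 x hx]
    · simp only [k5, h4, if_neg hq]

/-- Bounded iteration with an accumulator: `g n m a i v` is the value after round `i`, where `v` is
the value before. -/
theorem fold {f : ℕ → Mem → α → ℕ} {g : ℕ → Mem → α → ℕ → ℕ → ℕ} (hf : Comp f)
    (hg : Comp fun n m (p : (α × ℕ) × ℕ) => g n m p.1.1 p.1.2 p.2) :
    Comp fun n m a => Nat.rec (motive := fun _ => ℕ) (f n m a) (g n m a) n := by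
  obtain ⟨P, hP⟩ := hf
  obtain ⟨Q, hQ⟩ := hg
  refine ⟨P + Polynomial.X * (Q + 10) + 6, fun r ℓ hr hℓ => ?_⟩
  obtain ⟨p, hp⟩ := hP r ℓ hr hℓ
  -- the accumulator lives in register `r`, the counter in register `r + 1`
  obtain ⟨q, hq⟩ := hQ (r + 2) (fun k => if k = 0 then r else if k = 1 then r + 1 else ℓ (k - 2))
    (by omega) (fun k => by
      have := hℓ (k - 2)
      split_ifs <;> omega)
  refine ⟨.seq p (.seq (.assign (r + 1) (.const 0)) (.while (.sub (.reg 0) (.reg (r + 1)))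
    (.seq (.seq q (.assign r (.reg (r + 2))))
      (.assign (r + 1) (.add (.reg (r + 1)) (.const 1)))))), fun s a h => ?_⟩
  obtain ⟨t, s', h1, h2, h3, h4, h5⟩ := hp s a h
  let J : ℕ → State → Prop := fun i σ => (∀ x < r, σ.reg x = s.reg x) ∧ σ.arr = s.arr ∧
    σ.reg (r + 1) = i ∧
    σ.reg r = Nat.rec (motive := fun _ => ℕ) (f (s.reg 0) s.arr a) (g (s.reg 0) s.arr a) i
  obtain ⟨t', s'', k1, k2, k3⟩ := runs_while (p := .seq q (.assign r (.reg (r + 2)))) (c := r + 1)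
    (n := s.reg 0) (T := Q.eval (s.reg 0) + 2) (J := J) (fun i σ hσ => ⟨hσ.1 0 hr, hσ.2.2.1⟩)
    (fun i σ _ ⟨j1, j2, j3, j4⟩ => by
      obtain ⟨t, σ', l1, l2, l3, l4, l5⟩ := hq σ ((a, i), σ.reg r) ⟨rfl, j3, by
        refine Context.congr (ρ := s.reg) (fun k => ?_) h
        exact j1 _ (hℓ k)⟩
      rw [j1 0 hr] at l2 l5
      refine ⟨_, _, Runs.seq l1 (Runs.assign _ _ _), ?_, fun x hx => ?_, ?_, ?_, ?_⟩
      · simp [Term.cost]; omega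
      · rw [State.reg_setReg_of_ne _ _ (by omega), State.reg_setReg_of_ne _ _ (by omega),
          l3 x (by omega), j1 x hx]
      · rw [State.arr_setReg, State.arr_setReg, l4, j2]
      · rw [State.reg_setReg_self, State.reg_setReg_of_ne _ _ (by omega), l3 _ (by omega), j3]
      · rw [State.reg_setReg_of_ne _ _ (by omega), State.reg_setReg_self]
        simp only [Term.eval]
        rw [l5, j2, j4])
    (s.reg 0) 0 (s'.setReg (r + 1) 0) (by omega)
    ⟨fun x hx => by rw [State.reg_setReg_of_ne _ _ (by omega), h3 x hx], h4,
      State.reg_setReg_self _ _ _, (State.reg_setReg_of_ne _ _ (by omega)).trans h5⟩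
  refine ⟨_, _, Runs.seq h1 (Runs.seq (Runs.assign _ _ _) k1), ?_, k3.1, k3.2.1, k3.2.2.2⟩
  simp [Term.cost]
  simp only [Nat.add_assoc] at k2 ⊢
  norm_num at k2
  omega

theorem sum {f : ℕ → Mem → α → ℕ → ℕ} (hf : Comp fun n m (p : α × ℕ) => f n m p.1 p.2) :
    Comp fun n m a => ∑ i ∈ Finset.range n, f n m a i := by
  have h : Comp fun n m a => Nat.rec (motive := fun _ => ℕ) 0 (fun i v => v + f n m a i) n :=
    fold (const 0) (var.add hf.weaken)
  convert h using 4 with n m a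
  generalize f n m a = F
  induction n with
  | zero => rfl
  | succ n ih => rw [Finset.sum_range_succ, ih]

theorem mul_size {f : ℕ → Mem → α → ℕ} (hf : Comp f) : Comp fun n m a => f n m a * n := by
  have := sum (f := fun n m a _ => f n m a) hf.weaken
  simpa [mul_comm] using this

end Comp

namespace CompP

open Tuza.Comp

theorem lt {f g : ℕ → Mem → α → ℕ} (hf : Comp f) (hg : Comp g) :
    CompP fun n m a => f n m a < g n m a := by
  -- the sign of a truncated difference
  have h := (const 1).sub ((const 1).sub (hg.sub hf))
  unfold CompP
  convert h using 4 with n m a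
  by_cases hlt : f n m a < g n m a
  · rw [ind_pos hlt]; omega
  · rw [ind_neg hlt]; omega

theorem not {Q : ℕ → Mem → α → Prop} (h : CompP Q) : CompP fun n m a => ¬Q n m a := by
  have h' := (const 1).sub h
  unfold CompP
  convert h' using 4 with n m a
  by_cases hq : Q n m a <;> simp [ind, hq]

theorem and {Q R : ℕ → Mem → α → Prop} (hQ : CompP Q) (hR : CompP R) :
    CompP fun n m a => Q n m a ∧ R n m a := by
  have h' := lt (const 1) (Comp.add hQ hR)
  unfold CompP at *
  convert h' using 5 with n m a
  by_cases hq : Q n m a <;> by_cases hr : R n m a <;> simp [ind, hq, hr]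

theorem or {Q R : ℕ → Mem → α → Prop} (hQ : CompP Q) (hR : CompP R) :
    CompP fun n m a => Q n m a ∨ R n m a := by
  simpa only [not_and_or, not_not] using (hQ.not.and hR.not).not

theorem le {f g : ℕ → Mem → α → ℕ} (hf : Comp f) (hg : Comp g) :
    CompP fun n m a => f n m a ≤ g n m a := by
  simpa only [not_lt] using (lt hg hf).not

theorem eq {f g : ℕ → Mem → α → ℕ} (hf : Comp f) (hg : Comp g) :
    CompP fun n m a => f n m a = g n m a := by
  simpa only [← le_antisymm_iff] using (le hf hg).and (le hg hf)

theorem ex {Q : ℕ → Mem → α → ℕ → Prop} (hQ : CompP fun n m (p : α × ℕ) => Q n m p.1 p.2) :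
    CompP fun n m a => ∃ i < n, Q n m a i := by
  have h := lt (const 0) (sum (f := fun n m a i => ind (Q n m a i)) hQ)
  convert h using 4 with n m a
  rw [Nat.pos_iff_ne_zero, ne_eq, Finset.sum_eq_zero_iff]
  simp only [Finset.mem_range, not_forall, exists_prop]
  exact exists_congr fun i => and_congr_right fun _ => ind_ne_zero.symm

theorem all {Q : ℕ → Mem → α → ℕ → Prop} (hQ : CompP fun n m (p : α × ℕ) => Q n m p.1 p.2) :
    CompP fun n m a => ∀ i < n, Q n m a i := by
  have h := (ex (Q := fun n m a i => ¬Q n m a i) hQ.not).not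
  simpa only [not_exists, not_and, not_not] using h

end CompP

open Classical in
/-- The last index below `n` with the property `Q`, and `0` if there is none. -/
noncomputable def lastIndex (n : ℕ) (Q : ℕ → Prop) : ℕ :=
  Nat.rec (motive := fun _ => ℕ) 0 (fun i v => if Q i then i else v) n

theorem lastIndex_spec {n : ℕ} {Q : ℕ → Prop} (h : ∃ i < n, Q i) :
    lastIndex n Q < n ∧ Q (lastIndex n Q) := by
  induction n with
  | zero => obtain ⟨i, hi, -⟩ := h; omega
  | succ n ih =>
    by_cases hn : Q n
    · simp [lastIndex, hn]
    · have e : lastIndex (n + 1) Q = lastIndex n Q := by simp [lastIndex, hn]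
      obtain ⟨i, hi, hQ⟩ := h
      have hin : i ≠ n := by rintro rfl; exact hn hQ
      obtain ⟨h1, h2⟩ := ih ⟨i, by omega, hQ⟩
      rw [e]
      exact ⟨by omega, h2⟩

open Classical in
theorem Comp.lastIndex {Q : ℕ → Mem → α → ℕ → Prop}
    (hQ : CompP fun n m (p : α × ℕ) => Q n m p.1 p.2) :
    Comp fun n m a => lastIndex n (Q n m a) :=
  fold (const 0) (ite (Comp.weaken hQ) var.weaken var)

/-- The arrays after cell `i` of array `b` received the value `v`. -/
def Mem.set (m : Mem) (b i v : ℕ) : Mem := Function.update m b (Function.update (m b) i v)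

namespace Exec

theorem write {f g : ℕ → Mem → α → ℕ} (b : ℕ) (hf : Comp f) (hg : Comp g) :
    Exec fun n m a => Mem.set m b (f n m a) (g n m a) := by
  obtain ⟨P, hP⟩ := hf
  obtain ⟨Q, hQ⟩ := hg
  refine ⟨P + Q + 3, fun r ℓ hr hℓ => ?_⟩
  obtain ⟨p, hp⟩ := hP r ℓ hr hℓ
  obtain ⟨q, hq⟩ := hQ (r + 1) ℓ (by omega) fun k => (hℓ k).trans (by omega)
  refine ⟨.seq p (.seq q (.write b (.reg r) (.reg (r + 1)))), fun s a h => ?_⟩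
  obtain ⟨t, s', h1, h2, h3, h4, h5⟩ := hp s a h
  obtain ⟨t', s'', k1, k2, k3, k4, k5⟩ := hq s' a (Context.congr (fun k => h3 _ (hℓ k)) h)
  rw [h3 0 hr] at k2 k5
  refine ⟨_, _, Runs.seq h1 (Runs.seq k1 (Runs.write _ _ _ _)), ?_, fun x hx => ?_, ?_⟩
  · simp [Term.cost]; omega
  · change s''.reg x = _
    rw [k3 x (by omega), h3 x hx]
  · simp only [State.setArr, Term.eval, Mem.set]
    rw [k5, k3 r (by omega), h5, k4, h4]

theorem seq {F G : ℕ → Mem → α → Mem} (hF : Exec F) (hG : Exec G) :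
    Exec fun n m a => G n (F n m a) a := by
  obtain ⟨P, hP⟩ := hF
  obtain ⟨Q, hQ⟩ := hG
  refine ⟨P + Q, fun r ℓ hr hℓ => ?_⟩
  obtain ⟨p, hp⟩ := hP r ℓ hr hℓ
  obtain ⟨q, hq⟩ := hQ r ℓ hr hℓ
  refine ⟨.seq p q, fun s a h => ?_⟩
  obtain ⟨t, s', h1, h2, h3, h4⟩ := hp s a h
  obtain ⟨t', s'', k1, k2, k3, k4⟩ := hq s' a (Context.congr (fun k => h3 _ (hℓ k)) h)
  rw [h3 0 hr] at k2 k4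
  refine ⟨_, _, Runs.seq h1 k1, ?_, fun x hx => by rw [k3 x hx, h3 x hx], by rw [k4, h4]⟩
  simp; omega

/-- A local variable that keeps the value `f n m a`. -/
theorem letVar {f : ℕ → Mem → α → ℕ} {F : ℕ → Mem → α → ℕ → Mem} (hf : Comp f)
    (hF : Exec fun n m (p : α × ℕ) => F n m p.1 p.2) : Exec fun n m a => F n m a (f n m a) := by
  obtain ⟨P, hP⟩ := hf
  obtain ⟨Q, hQ⟩ := hF
  refine ⟨P + Q, fun r ℓ hr hℓ => ?_⟩
  obtain ⟨p, hp⟩ := hP r ℓ hr hℓ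
  obtain ⟨q, hq⟩ := hQ (r + 1) (fun k => if k = 0 then r else ℓ (k - 1)) (by omega) (fun k => by
    have := hℓ (k - 1)
    split_ifs <;> omega)
  refine ⟨.seq p q, fun s a h => ?_⟩
  obtain ⟨t, s', h1, h2, h3, h4, h5⟩ := hp s a h
  obtain ⟨t', s'', k1, k2, k3, k4⟩ := hq s' (a, s'.reg r)
    ⟨rfl, Context.congr (ρ := s.reg) (fun k => h3 _ (hℓ k)) h⟩
  rw [h3 0 hr] at k2 k4
  refine ⟨_, _, Runs.seq h1 k1, ?_, fun x hx => by rw [k3 x (by omega), h3 x hx], ?_⟩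
  · simp; omega
  · simp only [k4, h4, h5]

/-- A loop over the numbers below the size. -/
theorem loop {F : ℕ → Mem → α → ℕ → Mem} (hF : Exec fun n m (p : α × ℕ) => F n m p.1 p.2) :
    Exec fun n m a => Nat.rec (motive := fun _ => Mem) m (fun i m' => F n m' a i) n := by
  obtain ⟨Q, hQ⟩ := hF
  refine ⟨Polynomial.X * (Q + 8) + 6, fun r ℓ hr hℓ => ?_⟩
  obtain ⟨q, hq⟩ := hQ (r + 1) (fun k => if k = 0 then r else ℓ (k - 1)) (by omega) (fun k => by
    have := hℓ (k - 1)
    split_ifs <;> omega)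
  refine ⟨.seq (.assign r (.const 0)) (.while (.sub (.reg 0) (.reg r))
    (.seq q (.assign r (.add (.reg r) (.const 1))))), fun s a h => ?_⟩
  let J : ℕ → State → Prop := fun i σ => (∀ x < r, σ.reg x = s.reg x) ∧ σ.reg r = i ∧
    σ.arr = Nat.rec (motive := fun _ => Mem) s.arr (fun i m' => F (s.reg 0) m' a i) i
  obtain ⟨t', s'', k1, k2, k3⟩ := runs_while (p := q) (c := r)
    (n := s.reg 0) (T := Q.eval (s.reg 0)) (J := J) (fun i σ hσ => ⟨hσ.1 0 hr, hσ.2.1⟩)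
    (fun i σ _ ⟨j1, j2, j3⟩ => by
      obtain ⟨t, σ', l1, l2, l3, l4⟩ := hq σ (a, i) ⟨j2, by
        refine Context.congr (ρ := s.reg) (fun k => ?_) h
        exact j1 _ (hℓ k)⟩
      rw [j1 0 hr] at l2 l4
      refine ⟨_, _, l1, l2, fun x hx => ?_, ?_, ?_⟩
      · rw [State.reg_setReg_of_ne _ _ (by omega), l3 x (by omega), j1 x hx]
      · rw [State.reg_setReg_self, l3 _ (by omega), j2]
      · rw [State.arr_setReg, l4, j3])
    (s.reg 0) 0 (s.setReg r 0) (by omega)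
    ⟨fun x hx => by rw [State.reg_setReg_of_ne _ _ (by omega)], State.reg_setReg_self _ _ _, rfl⟩
  refine ⟨_, _, Runs.seq (Runs.assign _ _ _) k1, ?_, k3.1, k3.2.2⟩
  simp [Term.cost]
  omega

theorem iterate {F : ℕ → Mem → Mem} (hF : ∀ (β : Type) [Context β], Exec fun n m (_ : β) => F n m) :
    Exec fun n m (_ : α) => (F n)^[n] m := by
  have h := loop (α := α) (F := fun n m _ _ => F n m) (hF _)
  convert h using 4 with n m a
  suffices ∀ k, (F n)^[k] m = Nat.rec (motive := fun _ => Mem) m (fun _ m' => F n m') k from this n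
  intro k
  induction k with
  | zero => rfl
  | succ k ih => rw [Function.iterate_succ_apply', ih]

end Exec

end Machine

/-! ### Edge deletion and leaf triangles -/

section GraphLemmas

variable {V : Type*}

/-- The graph without the edge `uv`. -/
abbrev del (H : SimpleGraph V) (u v : V) : SimpleGraph V := H.deleteEdges {s(u, v)}

/-- The number of common neighbours of `u` and `v`; if `uv` is an edge, this is the number of
triangles that contain it. -/
noncomputable def codeg (H : SimpleGraph V) (u v : V) : ℕ := {w | H.Adj u w ∧ H.Adj v w}.ncard

/-- The edge `uv` lies in a triangle `uvw` whose other two edges lie in no further triangle. Such a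
triangle `uvw` is called a leaf. -/
def IsCenter (H : SimpleGraph V) (u v : V) : Prop :=
  ∃ w, H.Adj u w ∧ H.Adj v w ∧ codeg H u w = 1 ∧ codeg H v w = 1

/-- Some triangle is a leaf: at most one of its edges lies in another triangle. -/
def HasLeaf (H : SimpleGraph V) : Prop := ∃ u v, H.Adj u v ∧ IsCenter H u v

/-- Four vertices are pairwise adjacent. -/
def HasK4 (H : SimpleGraph V) : Prop :=
  ∃ a b c d, H.Adj a b ∧ H.Adj a c ∧ H.Adj a d ∧ H.Adj b c ∧ H.Adj b d ∧ H.Adj c d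

theorem del_adj {H : SimpleGraph V} {u v a b : V} :
    (del H u v).Adj a b ↔ H.Adj a b ∧ ¬(a = u ∧ b = v ∨ a = v ∧ b = u) := by
  simp [SimpleGraph.deleteEdges_adj]

theorem del_le (H : SimpleGraph V) (u v : V) : del H u v ≤ H := SimpleGraph.deleteEdges_le _

theorem codeg_comm (H : SimpleGraph V) (u v : V) : codeg H u v = codeg H v u := by
  simp only [codeg, and_comm]

theorem exists_ne_of_two_le_codeg {H : SimpleGraph V} {u v : V} (h : 2 ≤ codeg H u v) (w : V) :
    ∃ x, x ≠ w ∧ H.Adj u x ∧ H.Adj v x := by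
  obtain ⟨x, hx, hne⟩ := Set.exists_ne_of_one_lt_ncard h w
  exact ⟨x, hne, hx⟩

variable [Finite V]

theorem codeg_mono {H H' : SimpleGraph V} (h : H' ≤ H) (u v : V) : codeg H' u v ≤ codeg H u v :=
  Set.ncard_le_ncard fun _ hw => ⟨h hw.1, h hw.2⟩

theorem codeg_lt {H H' : SimpleGraph V} (h : H' ≤ H) {u v w : V} (hu : H.Adj u w) (hv : H.Adj v w)
    (hw : ¬(H'.Adj u w ∧ H'.Adj v w)) : codeg H' u v < codeg H u v :=
  Set.ncard_lt_ncard ⟨fun _ hx => ⟨h hx.1, h hx.2⟩, fun hs => hw (hs ⟨hu, hv⟩)⟩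

theorem codeg_pos {H : SimpleGraph V} {u v w : V} (hu : H.Adj u w) (hv : H.Adj v w) :
    1 ≤ codeg H u v :=
  (Set.ncard_pos).2 ⟨w, hu, hv⟩

theorem two_le_codeg {H : SimpleGraph V} {u v w x : V} (hu : H.Adj u w) (hv : H.Adj v w)
    (hu' : H.Adj u x) (hv' : H.Adj v x) (hwx : w ≠ x) : 2 ≤ codeg H u v :=
  (Set.one_lt_ncard).2 ⟨w, ⟨hu, hv⟩, x, ⟨hu', hv'⟩, hwx⟩

theorem eq_of_codeg_eq_one {H : SimpleGraph V} {u v w x : V} (h : codeg H u v = 1)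
    (hu : H.Adj u w) (hv : H.Adj v w) (hu' : H.Adj u x) (hv' : H.Adj v x) : w = x := by
  by_contra hne
  have := two_le_codeg hu hv hu' hv' hne
  omega

/-- Some edge in several triangles exists whose deletion creates a leaf. -/
def CanCreateLeaf (H : SimpleGraph V) : Prop :=
  ∃ u v, H.Adj u v ∧ 2 ≤ codeg H u v ∧ HasLeaf (del H u v)

/-- If every edge lies in at most two triangles, deleting an edge of a `K₄` turns the two triangles
of the `K₄` that avoid this edge into leaves. -/
theorem HasK4.canCreateLeaf {H : SimpleGraph V} (h2 : ∀ u v, H.Adj u v → codeg H u v ≤ 2)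
    (hK : HasK4 H) : CanCreateLeaf H := by
  obtain ⟨a, b, c, d, hab, hac, had, hbc, hbd, hcd⟩ := hK
  have ha'c : (del H a b).Adj c a := del_adj.2 ⟨hac.symm, by grind [SimpleGraph.Adj.ne]⟩
  have ha'd : (del H a b).Adj d a := del_adj.2 ⟨had.symm, by grind [SimpleGraph.Adj.ne]⟩
  have hc'd : (del H a b).Adj c d := del_adj.2 ⟨hcd, by grind [SimpleGraph.Adj.ne]⟩
  have hna : ¬(del H a b).Adj a b := fun h => (del_adj.1 h).2 (Or.inl ⟨rfl, rfl⟩)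
  refine ⟨a, b, hab, two_le_codeg hac hbc had hbd hcd.ne, c, d, hc'd, a, ha'c, ha'd, ?_, ?_⟩
  · have h1 := codeg_lt (del_le H a b) hbc.symm hab fun h => hna h.2
    have h3 := codeg_pos hc'd ha'd.symm
    have h4 := h2 _ _ hac.symm
    omega
  · have h1 := codeg_lt (del_le H a b) hbd.symm hab fun h => hna h.2
    have h3 := codeg_pos hc'd.symm ha'c.symm
    have h4 := h2 _ _ had.symm
    omega

/-- Deleting a suitable edge next to a triangle `abc` whose edge `ab` lies in no other triangle
turns `abc` into a leaf. -/
theorem canCreateLeaf_of_codeg_eq_one {H : SimpleGraph V} (hL : ¬HasLeaf H)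
    (h2 : ∀ u v, H.Adj u v → codeg H u v ≤ 2) {a b c : V} (hab : H.Adj a b) (hbc : H.Adj b c)
    (hac : H.Adj a c) (h : codeg H a b = 1) : CanCreateLeaf H := by
  have hbc2 : 2 ≤ codeg H b c := by
    by_contra hlt
    have := codeg_pos hab.symm hac.symm
    exact hL ⟨a, c, hac, b, hab, hbc.symm, h, by rw [codeg_comm]; omega⟩
  obtain ⟨d, hda, hbd, hcd⟩ := exists_ne_of_two_le_codeg hbc2 a
  have h2bc := h2 b c hbc
  -- the triangle `bcd` is no leaf, and an edge of it in two triangles is deleted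
  have key : ∀ x y, H.Adj x y → 2 ≤ codeg H x y → (x = b ∧ y = d ∨ x = c ∧ y = d) →
      CanCreateLeaf H := by
    intro x y hxy hxy2 hor
    have hab' : (del H x y).Adj a b := del_adj.2 ⟨hab, by grind [SimpleGraph.Adj.ne]⟩
    have hcb' : (del H x y).Adj c b := del_adj.2 ⟨hbc.symm, by grind [SimpleGraph.Adj.ne]⟩
    have hac' : (del H x y).Adj a c := del_adj.2 ⟨hac, by grind [SimpleGraph.Adj.ne]⟩
    refine ⟨x, y, hxy, hxy2, a, c, hac', b, hab', hcb', ?_, ?_⟩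
    · have := codeg_mono (del_le H x y) a b
      have := codeg_pos hac' hcb'.symm
      omega
    · have := codeg_lt (del_le H x y) (u := c) (v := b) hcd hbd (by
        rw [del_adj, del_adj]
        grind)
      have := codeg_pos hac'.symm hab'.symm
      rw [codeg_comm H c b] at *
      omega
  by_cases h1 : codeg H b d = 1
  · have h1' : codeg H c d ≠ 1 := fun h1' => hL ⟨b, c, hbc, d, hbd, hcd, h1, h1'⟩
    have := codeg_pos hbc.symm hbd.symm
    exact key c d hcd (by omega) (Or.inr ⟨rfl, rfl⟩)
  · have := codeg_pos hbc hcd.symm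
    exact key b d hbd (by omega) (Or.inl ⟨rfl, rfl⟩)

/-- If deleting `uv` leaves two edges `ab` and `ac` of a triangle in no other triangle, while both
were in a further triangle before, then these two further triangles share the edge `uv`. -/
theorem hasK4_of_isolated_aux {H : SimpleGraph V} {u v a b c : V}
    (hab : (del H u v).Adj a b) (hbc : (del H u v).Adj b c) (hac : (del H u v).Adj a c)
    (h1 : codeg (del H u v) a b = 1) (h2 : codeg (del H u v) a c = 1)
    (h1' : 2 ≤ codeg H a b) (h2' : 2 ≤ codeg H a c) : HasK4 H := by
  obtain ⟨d, hdc, had, hbd⟩ := exists_ne_of_two_le_codeg h1' c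
  obtain ⟨x, hxb, hax, hcx⟩ := exists_ne_of_two_le_codeg h2' b
  have hd : ¬((del H u v).Adj a d ∧ (del H u v).Adj b d) := fun h =>
    hdc (eq_of_codeg_eq_one h1 h.1 h.2 hac hbc)
  have hx : ¬((del H u v).Adj a x ∧ (del H u v).Adj c x) := fun h =>
    hxb (eq_of_codeg_eq_one h2 h.1 h.2 hab hbc.symm)
  rw [del_adj] at *
  rw [del_adj] at *
  -- the deleted edge lies in `abd` and in `acx`, hence is `ad`, and `x = d`
  have hdx : d = x := by grind [SimpleGraph.Adj.ne]
  subst hdx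
  exact ⟨a, b, c, d, hab.1, hac.1, had, hbc.1, hbd, hcx⟩

/-- In a graph without leaves and without `K₄`, deleting an edge does not isolate a triangle. -/
theorem not_isolated_del {H : SimpleGraph V} (hL : ¬HasLeaf H) (hK : ¬HasK4 H) {u v a b c : V}
    (hab : (del H u v).Adj a b) (hbc : (del H u v).Adj b c) (hac : (del H u v).Adj a c) :
    ¬(codeg (del H u v) a b = 1 ∧ codeg (del H u v) b c = 1 ∧ codeg (del H u v) a c = 1) := by
  rintro ⟨h1, h2, h3⟩
  have le := del_le H u v
  have p1 := codeg_pos (le hac) (le hbc)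
  have p2 := codeg_pos (le hab.symm) (le hac.symm)
  have p3 := codeg_pos (le hab) (le hbc.symm)
  have n1 : ¬(codeg H a b = 1 ∧ codeg H b c = 1) := fun h =>
    hL ⟨a, c, le hac, b, le hab, le hbc.symm, h.1, by rw [codeg_comm]; exact h.2⟩
  have n2 : ¬(codeg H a b = 1 ∧ codeg H a c = 1) := fun h =>
    hL ⟨b, c, le hbc, a, le hab.symm, le hac.symm, by rw [codeg_comm]; exact h.1,
      by rw [codeg_comm]; exact h.2⟩
  have n3 : ¬(codeg H b c = 1 ∧ codeg H a c = 1) := fun h =>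
    hL ⟨a, b, le hab, c, le hac, le hbc, h.2, h.1⟩
  have k1 : ¬(2 ≤ codeg H a b ∧ 2 ≤ codeg H a c) := fun h =>
    hK (hasK4_of_isolated_aux hab hbc hac h1 h3 h.1 h.2)
  have k2 : ¬(2 ≤ codeg H a b ∧ 2 ≤ codeg H b c) := fun h =>
    hK (hasK4_of_isolated_aux hab.symm hac hbc (by rw [codeg_comm]; exact h1) h2
      (by rw [codeg_comm]; exact h.1) h.2)
  have k3 : ¬(2 ≤ codeg H a c ∧ 2 ≤ codeg H b c) := fun h =>
    hK (hasK4_of_isolated_aux hac.symm hab hbc.symm (by rw [codeg_comm]; exact h3)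
      (by rw [codeg_comm]; exact h2) (by rw [codeg_comm]; exact h.1)
      (by rw [codeg_comm]; exact h.2))
  omega

end GraphLemmas

/-! ### Counting triangles and packings -/

section Counting

variable {V : Type*}

theorem triangles_mono {H H' : SimpleGraph V} (h : H' ≤ H) : triangles H' ⊆ triangles H := by
  rintro T ⟨a, b, c, h1, h2, h3, rfl⟩
  exact ⟨a, b, c, h h1, h h2, h h3, rfl⟩

theorem triangles_del (H : SimpleGraph V) (u v : V) :
    triangles (del H u v) = {T ∈ triangles H | s(u, v) ∉ T} := by
  ext T
  constructor
  · rintro ⟨a, b, c, h1, h2, h3, rfl⟩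
    refine ⟨⟨a, b, c, del_le _ _ _ h1, del_le _ _ _ h2, del_le _ _ _ h3, rfl⟩, ?_⟩
    rw [SimpleGraph.deleteEdges_adj] at h1 h2 h3
    rintro (h | h | h)
    · exact h1.2 h.symm
    · exact h2.2 h.symm
    · exact h3.2 h.symm
  · rintro ⟨⟨a, b, c, h1, h2, h3, rfl⟩, hT⟩
    simp only [Set.mem_insert_iff, Set.mem_singleton_iff, not_or] at hT
    refine ⟨a, b, c, ?_, ?_, ?_, rfl⟩ <;> rw [SimpleGraph.deleteEdges_adj]
    · exact ⟨h1, fun h => hT.1 h.symm⟩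
    · exact ⟨h2, fun h => hT.2.1 h.symm⟩
    · exact ⟨h3, fun h => hT.2.2 h.symm⟩

/-- A triangle that contains the edge `uv` is determined by its third vertex. -/
theorem exists_eq_of_mem_triangle {H : SimpleGraph V} {u v : V} {T : Set (Sym2 V)}
    (hT : T ∈ triangles H) (he : s(u, v) ∈ T) :
    ∃ w, H.Adj u w ∧ H.Adj v w ∧ T = {s(u, v), s(v, w), s(u, w)} := by
  obtain ⟨a, b, c, h1, h2, h3, rfl⟩ := hT
  have key : ∀ {x y z : V}, H.Adj x y → H.Adj y z → H.Adj x z → s(u, v) = s(x, y) →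
      ∃ w, H.Adj u w ∧ H.Adj v w ∧
        ({s(x, y), s(y, z), s(x, z)} : Set (Sym2 V)) = {s(u, v), s(v, w), s(u, w)} := by
    intro x y z _ hyz hxz h
    rcases Sym2.eq_iff.1 h with ⟨rfl, rfl⟩ | ⟨rfl, rfl⟩
    · exact ⟨z, hxz, hyz, rfl⟩
    · refine ⟨z, hyz, hxz, ?_⟩
      rw [Sym2.eq_swap, Set.pair_comm]
  rcases he with h | h | h
  · exact key h1 h2 h3 h
  · obtain ⟨w, k1, k2, k3⟩ := key h2 h3.symm h1.symm h
    refine ⟨w, k1, k2, k3 ▸ ?_⟩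
    ext e
    simp only [Set.mem_insert_iff, Set.mem_singleton_iff, Sym2.eq_swap (a := c)]
    rw [Sym2.eq_swap (a := b) (b := a)]
    tauto
  · obtain ⟨w, k1, k2, k3⟩ := key h3 h2.symm h1 h
    refine ⟨w, k1, k2, k3 ▸ ?_⟩
    ext e
    simp only [Set.mem_insert_iff, Set.mem_singleton_iff]
    rw [Sym2.eq_swap (a := c) (b := b)]
    tauto

/-- The edges that lie in a triangle. -/
def triangleEdges (H : SimpleGraph V) : Set (Sym2 V) := {e | ∃ T ∈ triangles H, e ∈ T}

theorem mem_triangleEdges {H : SimpleGraph V} {u v w : V} (huv : H.Adj u v) (huw : H.Adj u w)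
    (hvw : H.Adj v w) : s(u, v) ∈ triangleEdges H :=
  ⟨_, ⟨u, v, w, huv, hvw, huw, rfl⟩, by simp⟩

variable [Finite V]

theorem ncard_triangles_del {H : SimpleGraph V} {u v : V} (h : H.Adj u v) :
    (triangles H).ncard = (triangles (del H u v)).ncard + codeg H u v := by
  have e : triangles H = triangles (del H u v) ∪ {T ∈ triangles H | s(u, v) ∈ T} := by
    rw [triangles_del]
    ext T
    simp only [Set.mem_union, Set.mem_ofPred_eq]
    tauto
  have hd : Disjoint (triangles (del H u v)) {T ∈ triangles H | s(u, v) ∈ T} := by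
    rw [triangles_del, Set.disjoint_left]
    exact fun T hT hT' => hT.2 hT'.2
  have hi : {T ∈ triangles H | s(u, v) ∈ T} =
      (fun w => ({s(u, v), s(v, w), s(u, w)} : Set (Sym2 V))) '' {w | H.Adj u w ∧ H.Adj v w} := by
    ext T
    constructor
    · rintro ⟨hT, he⟩
      obtain ⟨w, h1, h2, rfl⟩ := exists_eq_of_mem_triangle hT he
      exact ⟨w, ⟨h1, h2⟩, rfl⟩
    · rintro ⟨w, ⟨h1, h2⟩, rfl⟩
      exact ⟨⟨u, v, w, h, h2, h1, rfl⟩, by simp⟩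
  have hinj : Set.InjOn (fun w => ({s(u, v), s(v, w), s(u, w)} : Set (Sym2 V)))
      {w | H.Adj u w ∧ H.Adj v w} := by
    intro w hw x hx hwx
    have : s(u, w) ∈ ({s(u, v), s(v, x), s(u, x)} : Set (Sym2 V)) := by
      dsimp only at hwx
      rw [← hwx]
      simp
    have h1 := h.ne
    have h2 := hw.2.ne
    simp only [Set.mem_insert_iff, Set.mem_singleton_iff, Sym2.eq_iff] at this
    grind
  conv_lhs => rw [e]
  rw [Set.ncard_union_eq hd, hi, hinj.ncard_image, codeg]

theorem bddAbove_packing (H : SimpleGraph V) :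
    BddAbove {k | ∃ P, IsTrianglePacking H P ∧ P.ncard = k} := by
  refine ⟨(triangles H).ncard, ?_⟩
  rintro k ⟨P, hP, rfl⟩
  exact Set.ncard_le_ncard hP.1

theorem IsTrianglePacking.ncard_le {H : SimpleGraph V} {P : Set (Set (Sym2 V))}
    (hP : IsTrianglePacking H P) : P.ncard ≤ packingNumber H :=
  le_csSup (bddAbove_packing H) ⟨P, hP, rfl⟩

theorem exists_packing (H : SimpleGraph V) :
    ∃ P, IsTrianglePacking H P ∧ P.ncard = packingNumber H :=
  Nat.sSup_mem (s := {k | ∃ P, IsTrianglePacking H P ∧ P.ncard = k})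
    ⟨0, ∅, ⟨Set.empty_subset _, Set.pairwiseDisjoint_empty⟩, Set.ncard_empty _⟩
    (bddAbove_packing H)

theorem packingNumber_mono {H H' : SimpleGraph V} (h : H' ≤ H) :
    packingNumber H' ≤ packingNumber H := by
  obtain ⟨P, hP, hc⟩ := exists_packing H'
  rw [← hc]
  exact IsTrianglePacking.ncard_le ⟨hP.1.trans (triangles_mono h), hP.2⟩

/-- A leaf with center `uv` can be added to every packing that avoids `uv`. -/
theorem IsCenter.packingNumber_del_lt {H : SimpleGraph V} {u v : V} (huv : H.Adj u v)
    (hc : IsCenter H u v) : packingNumber (del H u v) + 1 ≤ packingNumber H := by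
  obtain ⟨P, hP, hcard⟩ := exists_packing (del H u v)
  obtain ⟨w, huw, hvw, h1, h2⟩ := hc
  have hT : ({s(u, v), s(v, w), s(u, w)} : Set (Sym2 V)) ∈ triangles H :=
    ⟨u, v, w, huv, hvw, huw, rfl⟩
  have hsub := hP.1
  rw [triangles_del] at hsub
  have hnot : ({s(u, v), s(v, w), s(u, w)} : Set (Sym2 V)) ∉ P := fun h => (hsub h).2 (by simp)
  rw [← hcard, ← Set.ncard_insert_of_notMem hnot]
  refine IsTrianglePacking.ncard_le ⟨Set.insert_subset hT fun T h => (hsub h).1, ?_⟩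
  refine hP.2.insert fun T h _ => Set.disjoint_left.2 fun e he heT => ?_
  obtain ⟨hTH, hTe⟩ := hsub h
  rcases he with rfl | rfl | rfl
  · exact hTe heT
  · obtain ⟨x, k1, k2, rfl⟩ := exists_eq_of_mem_triangle hTH heT
    obtain rfl := eq_of_codeg_eq_one h2 huv.symm huw.symm k1 k2
    exact hTe (by simp [Sym2.eq_swap])
  · obtain ⟨x, k1, k2, rfl⟩ := exists_eq_of_mem_triangle hTH heT
    obtain rfl := eq_of_codeg_eq_one h1 huv hvw.symm k1 k2
    exact hTe (by simp)

/-- Deleting `uv` makes at most `uv` and two further edges for each triangle on `uv` leave the set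
of edges in triangles. -/
theorem ncard_triangleEdges_le (H : SimpleGraph V) (u v : V) :
    (triangleEdges H).ncard ≤ (triangleEdges (del H u v)).ncard + 1 + 2 * codeg H u v := by
  set N := {w | H.Adj u w ∧ H.Adj v w}
  have hsub : triangleEdges H ⊆ (triangleEdges (del H u v) ∪ {s(u, v)}) ∪
      ((fun w => s(v, w)) '' N ∪ (fun w => s(u, w)) '' N) := by
    rintro e ⟨T, hT, he⟩
    by_cases h : s(u, v) ∈ T
    · obtain ⟨w, h1, h2, rfl⟩ := exists_eq_of_mem_triangle hT h
      rcases he with rfl | rfl | rfl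
      · exact Or.inl (Or.inr rfl)
      · exact Or.inr (Or.inl ⟨w, ⟨h1, h2⟩, rfl⟩)
      · exact Or.inr (Or.inr ⟨w, ⟨h1, h2⟩, rfl⟩)
    · exact Or.inl (Or.inl ⟨T, by rw [triangles_del]; exact ⟨hT, h⟩, he⟩)
  have h1 := Set.ncard_le_ncard hsub
  have h2 := Set.ncard_union_le (triangleEdges (del H u v) ∪ {s(u, v)})
      ((fun w => s(v, w)) '' N ∪ (fun w => s(u, w)) '' N)
  have h3 := Set.ncard_union_le (triangleEdges (del H u v)) {s(u, v)}
  have h4 := Set.ncard_union_le ((fun w => s(v, w)) '' N) ((fun w => s(u, w)) '' N)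
  have h5 := Set.ncard_image_le (f := fun w => s(v, w)) (Set.toFinite N)
  have h6 := Set.ncard_image_le (f := fun w => s(u, w)) (Set.toFinite N)
  rw [Set.ncard_singleton] at h3
  change _ ≤ _ + 1 + 2 * N.ncard
  omega

/-- If `uv` is not a center, at most one further edge for each triangle on `uv` leaves the set of
edges in triangles. -/
theorem ncard_triangleEdges_le_of_not_isCenter {H : SimpleGraph V} {u v : V}
    (hc : ¬IsCenter H u v) :
    (triangleEdges H).ncard ≤ (triangleEdges (del H u v)).ncard + 1 + codeg H u v := by
  classical
  set N := {w | H.Adj u w ∧ H.Adj v w}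
  set g : V → Sym2 V := fun w => if codeg H u w = 1 then s(u, w) else s(v, w)
  -- an edge `xz` of a triangle `xyz` on `xy` survives if it lies in two triangles
  have surv : ∀ {x y z : V}, H.Adj x y → H.Adj x z → H.Adj y z → codeg H x z ≠ 1 →
      s(x, y) = s(u, v) → s(x, z) ∈ triangleEdges (del H u v) := by
    intro x y z hxy hxz hyz h1 he
    have := codeg_pos hxy hyz.symm
    obtain ⟨t, hty, hxt, hzt⟩ := exists_ne_of_two_le_codeg (H := H) (u := x) (v := z) (by omega) y
    have hne := hxy.ne
    have hne' := hyz.ne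
    have hne2 := hxz.ne
    refine mem_triangleEdges (w := t) ?_ ?_ ?_ <;>
      refine SimpleGraph.deleteEdges_adj.2 ⟨by assumption, ?_⟩ <;>
      rw [Set.mem_singleton_iff, ← he, Sym2.eq_iff] <;> grind
  have hsub : triangleEdges H ⊆ (triangleEdges (del H u v) ∪ {s(u, v)}) ∪ g '' N := by
    rintro e ⟨T, hT, he⟩
    by_cases h : s(u, v) ∈ T
    · have huv : H.Adj u v := by
        obtain ⟨a, b, c, h1, h2, h3, rfl⟩ := hT
        rcases h with h | h | h <;> rw [← SimpleGraph.mem_edgeSet, h] <;> assumption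
      obtain ⟨w, h1, h2, rfl⟩ := exists_eq_of_mem_triangle hT h
      rcases he with rfl | rfl | rfl
      · exact Or.inl (Or.inr rfl)
      · by_cases hw : codeg H u w = 1
        · have hw' : codeg H v w ≠ 1 := fun hw' => hc ⟨w, h1, h2, hw, hw'⟩
          exact Or.inl (Or.inl (surv huv.symm h2 h1 hw' Sym2.eq_swap))
        · exact Or.inr ⟨w, ⟨h1, h2⟩, if_neg hw⟩
      · by_cases hw : codeg H u w = 1
        · exact Or.inr ⟨w, ⟨h1, h2⟩, if_pos hw⟩
        · exact Or.inl (Or.inl (surv huv h1 h2 hw rfl))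
    · exact Or.inl (Or.inl ⟨T, by rw [triangles_del]; exact ⟨hT, h⟩, he⟩)
  have h1 := Set.ncard_le_ncard hsub
  have h2 := Set.ncard_union_le (triangleEdges (del H u v) ∪ {s(u, v)}) (g '' N)
  have h3 := Set.ncard_union_le (triangleEdges (del H u v)) {s(u, v)}
  have h4 := Set.ncard_image_le (f := g) (Set.toFinite N)
  rw [Set.ncard_singleton] at h3
  change _ ≤ _ + 1 + N.ncard
  omega

end Counting

/-! ### The greedy rule -/

section Greedy

variable {V : Type*}

open Classical in
/-- The priority of the edge `uv` in the greedy deletion of edges: centers of leaves come first,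
then edges in at least three triangles, then edges in two triangles whose deletion creates a leaf,
then other edges in two triangles. Pairs of priority `0` are not deleted. -/
noncomputable def prio (H : SimpleGraph V) (u v : V) : ℕ :=
  if ¬H.Adj u v then 0
  else if IsCenter H u v then 4
  else if 3 ≤ codeg H u v then 3
  else if 2 ≤ codeg H u v then (if HasLeaf (del H u v) then 2 else 1)
  else 0

/-- `S` is the set of edges deleted by a run of the greedy rule that starts at `H` and continues
until all priorities vanish. -/
inductive GreedyRun : SimpleGraph V → Set (Sym2 V) → Prop
  | nil {H : SimpleGraph V} (h : ∀ u v, prio H u v = 0) : GreedyRun H ∅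
  | cons {H : SimpleGraph V} {u v : V} {S : Set (Sym2 V)} (h0 : prio H u v ≠ 0)
      (h : ∀ x y, prio H x y ≤ prio H u v) (hS : GreedyRun (del H u v) S) :
      GreedyRun H (insert s(u, v) S)

theorem adj_of_prio {H : SimpleGraph V} {u v : V} (h : prio H u v ≠ 0) : H.Adj u v := by
  by_contra hn
  simp [prio, hn] at h

/-- Lower bounds for the priority, and what can be concluded from them. -/
theorem prio_spec (H : SimpleGraph V) {u v : V} (h : H.Adj u v) :
    (IsCenter H u v → 4 ≤ prio H u v) ∧ (3 ≤ codeg H u v → 3 ≤ prio H u v) ∧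
    (2 ≤ codeg H u v → HasLeaf (del H u v) → 2 ≤ prio H u v) ∧
    (2 ≤ codeg H u v → 1 ≤ prio H u v) ∧
    (4 ≤ prio H u v → IsCenter H u v) ∧ (3 ≤ prio H u v → IsCenter H u v ∨ 3 ≤ codeg H u v) ∧
    (2 ≤ prio H u v → IsCenter H u v ∨ 3 ≤ codeg H u v ∨
      2 ≤ codeg H u v ∧ HasLeaf (del H u v)) ∧
    (1 ≤ prio H u v → IsCenter H u v ∨ 2 ≤ codeg H u v) := by
  unfold prio
  grind

theorem GreedyRun.subset {H : SimpleGraph V} {S : Set (Sym2 V)} (h : GreedyRun H S) :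
    S ⊆ H.edgeSet := by
  induction h with
  | nil => exact Set.empty_subset _
  | cons h0 _ _ ih =>
    exact Set.insert_subset (adj_of_prio h0) (ih.trans (SimpleGraph.edgeSet_mono (del_le _ _ _)))

variable [Finite V]

/-- The greedy rule does not stop before all triangles are destroyed: a triangle none of whose edges
lies in another triangle is a leaf. -/
theorem exists_prio_ne_zero {H : SimpleGraph V} {T : Set (Sym2 V)} (hT : T ∈ triangles H) :
    ∃ u v, prio H u v ≠ 0 := by
  obtain ⟨a, b, c, hab, hbc, hac, rfl⟩ := hT
  by_contra! hall
  have key : ∀ x y, H.Adj x y → ¬IsCenter H x y ∧ ¬2 ≤ codeg H x y := by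
    intro x y hxy
    have h := prio_spec H hxy
    rw [hall x y] at h
    exact ⟨fun k => by have := h.1 k; omega, fun k => by have := h.2.2.2.1 k; omega⟩
  have h1 := codeg_pos hab hbc.symm
  have h2 := codeg_pos hab.symm hac.symm
  have h3 := (key a c hac).2
  have h4 := (key b c hbc).2
  exact (key a b hab).1 ⟨c, hac, hbc, by omega, by omega⟩

theorem GreedyRun.isTriangleCover {H : SimpleGraph V} {S : Set (Sym2 V)} (h : GreedyRun H S) :
    IsTriangleCover H S := by
  refine ⟨h.subset, ?_⟩
  induction h with
  | nil h =>
    intro T hT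
    obtain ⟨u, v, huv⟩ := exists_prio_ne_zero hT
    exact absurd (h u v) huv
  | @cons H u v S h0 _ _ ih =>
    intro T hT
    by_cases he : s(u, v) ∈ T
    · exact ⟨_, Set.mem_insert _ _, he⟩
    · obtain ⟨e, heS, heT⟩ := ih T (by rw [triangles_del]; exact ⟨hT, he⟩)
      exact ⟨e, Set.mem_insert_of_mem _ heS, heT⟩

theorem GreedyRun.ncard_insert {H : SimpleGraph V} {u v : V} {S : Set (Sym2 V)}
    (h : GreedyRun (del H u v) S) : (insert s(u, v) S).ncard = S.ncard + 1 := by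
  refine Set.ncard_insert_of_notMem fun hm => ?_
  have := h.subset hm
  rw [SimpleGraph.mem_edgeSet, SimpleGraph.deleteEdges_adj] at this
  exact this.2 rfl

/-- The number of deleted edges in terms of the number of edges in triangles. A deletion in more
than one triangle lowers `2 |triangles| - |triangleEdges|`, except at a leaf, where the packing
number drops as well. -/
theorem GreedyRun.ncard_add_le {H : SimpleGraph V} {S : Set (Sym2 V)} (h : GreedyRun H S) :
    S.ncard + (triangleEdges H).ncard ≤ 2 * packingNumber H + 2 * (triangles H).ncard := by
  induction h with
  | @nil H h =>
    have he : triangleEdges H = ∅ := by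
      refine Set.eq_empty_of_forall_notMem ?_
      rintro e ⟨T, hT, -⟩
      obtain ⟨u, v, huv⟩ := exists_prio_ne_zero hT
      exact huv (h u v)
    simp [he]
  | @cons H u v S h0 hmax hS ih =>
    have huv := adj_of_prio h0
    have hm := ncard_triangles_del huv
    have hn := packingNumber_mono (del_le H u v)
    rw [hS.ncard_insert]
    by_cases hc : IsCenter H u v
    · have := hc.packingNumber_del_lt huv
      have := ncard_triangleEdges_le H u v
      omega
    · have h2 : 2 ≤ codeg H u v :=
        ((prio_spec H huv).2.2.2.2.2.2.2 (by omega)).resolve_left hc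
      have := ncard_triangleEdges_le_of_not_isCenter hc
      omega

/-- The number of deleted edges in terms of the number of triangles. The deletion of a center is
paid for by the packing, and that of an edge in three triangles by these triangles. In the
remaining case every edge lies in at most two triangles, and a deletion leaves a deficit of `1` in
the inequality, which the leaves that it creates make up for. So the induction also records the
gain from leaves and from the possibility of creating a leaf. -/
theorem GreedyRun.three_mul_ncard_le_aux {H : SimpleGraph V} {S : Set (Sym2 V)}
    (h : GreedyRun H S) :
    3 * S.ncard ≤ 3 * packingNumber H + (triangles H).ncard ∧
    (HasLeaf H → 3 * S.ncard + 1 ≤ 3 * packingNumber H + (triangles H).ncard) ∧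
    (HasLeaf H → (∀ a b c, H.Adj a b → H.Adj b c → H.Adj a c →
      ¬(codeg H a b = 1 ∧ codeg H b c = 1 ∧ codeg H a c = 1)) →
      3 * S.ncard + 2 ≤ 3 * packingNumber H + (triangles H).ncard) ∧
    (¬HasLeaf H → (∀ a b, H.Adj a b → codeg H a b ≤ 2) → ¬HasK4 H → CanCreateLeaf H →
      3 * S.ncard + 1 ≤ 3 * packingNumber H + (triangles H).ncard) := by
  induction h with
  | @nil H h =>
    have hL : ¬HasLeaf H := by
      rintro ⟨u, v, huv, hc⟩
      have := (prio_spec H huv).1 hc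
      have := h u v
      omega
    have hC : ¬CanCreateLeaf H := by
      rintro ⟨u, v, huv, h2, -⟩
      have := (prio_spec H huv).2.2.2.1 h2
      have := h u v
      omega
    exact ⟨by simp, fun k => absurd k hL, fun k => absurd k hL, fun _ _ _ k => absurd k hC⟩
  | @cons H u v S h0 hmax hS ih =>
    have huv := adj_of_prio h0
    have hm := ncard_triangles_del huv
    have hn := packingNumber_mono (del_le H u v)
    have le := del_le H u v
    have spec := prio_spec H huv
    obtain ⟨ihB, ihL, ihI, ihT⟩ := ih
    rw [hS.ncard_insert]
    by_cases hL : HasLeaf H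
    · have hc : IsCenter H u v := by
        obtain ⟨x, y, hxy, hc⟩ := hL
        exact spec.2.2.2.2.1 (((prio_spec H hxy).1 hc).trans (hmax x y))
      have hp := hc.packingNumber_del_lt huv
      obtain ⟨w, huw, hvw, h1, h2⟩ := hc
      have hd := codeg_pos huw hvw
      refine ⟨by omega, fun _ => by omega, fun _ hiso => ?_, fun k => absurd hL k⟩
      have : codeg H u v ≠ 1 := fun h3 => hiso u v w huv hvw huw ⟨h3, h2, h1⟩
      omega
    · have hnc : ¬IsCenter H u v := fun hc => hL ⟨u, v, huv, hc⟩
      refine ⟨?_, fun k => absurd k hL, fun k => absurd k hL, ?_⟩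
      · by_cases h3 : ∀ a b, H.Adj a b → codeg H a b ≤ 2
        · by_cases hC : CanCreateLeaf H
          · obtain ⟨x, y, hxy, h2, hl⟩ := hC
            have h2' := (spec.2.2.2.2.2.2.1
              (((prio_spec H hxy).2.2.1 h2 hl).trans (hmax x y))).resolve_left hnc
            have := h3 u v huv
            have hl' : HasLeaf (del H u v) := by
              rcases h2' with h | h
              · omega
              · exact h.2
            have := ihL hl'
            omega
          · have h2 : 2 ≤ codeg H u v := (spec.2.2.2.2.2.2.2 (by omega)).resolve_left hnc
            have h3' : ∀ a b, (del H u v).Adj a b → codeg (del H u v) a b ≤ 2 := fun a b hab =>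
              (codeg_mono le a b).trans (h3 a b (le hab))
            have hL' : ¬HasLeaf (del H u v) := fun hl => hC ⟨u, v, huv, h2, hl⟩
            have hK' : ¬HasK4 (del H u v) := by
              rintro ⟨a, b, c, d, k1, k2, k3, k4, k5, k6⟩
              exact hC (HasK4.canCreateLeaf h3
                ⟨a, b, c, d, le k1, le k2, le k3, le k4, le k5, le k6⟩)
            -- a triangle next to a deleted one has now an edge that lies in no other triangle
            have hC' : CanCreateLeaf (del H u v) := by
              obtain ⟨w, hwu, huw, hvw⟩ := exists_ne_of_two_le_codeg h2 u
              have hpos := codeg_pos huv hvw.symm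
              have hne : codeg H u w ≠ 1 := fun h1 =>
                hC (canCreateLeaf_of_codeg_eq_one hL h3 huw hvw.symm huv h1)
              obtain ⟨z, hzv, huz, hwz⟩ :=
                exists_ne_of_two_le_codeg (H := H) (u := u) (v := w) (by omega) v
              have k1 : (del H u v).Adj u w := del_adj.2 ⟨huw, by grind [SimpleGraph.Adj.ne]⟩
              have k2 : (del H u v).Adj w z := del_adj.2 ⟨hwz, by grind [SimpleGraph.Adj.ne]⟩
              have k3 : (del H u v).Adj u z := del_adj.2 ⟨huz, by grind [SimpleGraph.Adj.ne]⟩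
              refine canCreateLeaf_of_codeg_eq_one hL' h3' k1 k2 k3 ?_
              have := codeg_lt le huv hvw.symm fun h => (del_adj.1 h.1).2 (Or.inl ⟨rfl, rfl⟩)
              have := codeg_pos k3 k2
              have := h3 u w huw
              omega
            have := ihT hL' h3' hK' hC'
            omega
        · push Not at h3
          obtain ⟨x, y, hxy, h3⟩ := h3
          have := (spec.2.2.2.2.2.1
            (((prio_spec H hxy).2.1 h3).trans (hmax x y))).resolve_left hnc
          omega
      · intro _ h3 hK ⟨x, y, hxy, h2, hl⟩
        have h2' := (spec.2.2.2.2.2.2.1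
          (((prio_spec H hxy).2.2.1 h2 hl).trans (hmax x y))).resolve_left hnc
        have := h3 u v huv
        have hl' : 2 ≤ codeg H u v ∧ HasLeaf (del H u v) := by
          rcases h2' with h | h
          · omega
          · exact h
        have := ihI hl'.2 fun a b c k1 k2 k3 => not_isolated_del hL hK k1 k2 k3
        omega

theorem GreedyRun.three_mul_ncard_le {H : SimpleGraph V} {S : Set (Sym2 V)} (h : GreedyRun H S) :
    3 * S.ncard ≤ 3 * packingNumber H + (triangles H).ncard :=
  h.three_mul_ncard_le_aux.1

theorem exists_greedyRun (H : SimpleGraph V) : ∃ S, GreedyRun H S := by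
  induction hk : H.edgeSet.ncard using Nat.strong_induction_on generalizing H with
  | _ k ih =>
    by_cases h : ∀ u v, prio H u v = 0
    · exact ⟨∅, .nil h⟩
    · push Not at h
      obtain ⟨u₀, v₀, h₀⟩ := h
      have : Nonempty (V × V) := ⟨(u₀, v₀)⟩
      obtain ⟨⟨u, v⟩, huv⟩ := Finite.exists_max fun p : V × V => prio H p.1 p.2
      have h1 : prio H u v ≠ 0 := fun h => h₀ (Nat.le_zero.1 (h ▸ huv (u₀, v₀)))
      obtain ⟨S, hS⟩ := ih _ (by
        rw [← hk]
        refine Set.ncard_lt_ncard ⟨SimpleGraph.edgeSet_mono (del_le H u v), fun hsub => ?_⟩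
        have := hsub (show s(u, v) ∈ H.edgeSet from adj_of_prio h1)
        rw [SimpleGraph.mem_edgeSet, SimpleGraph.deleteEdges_adj] at this
        exact this.2 rfl) (del H u v) rfl
      exact ⟨_, .cons h1 (fun x y => huv (x, y)) hS⟩

/-- The greedy cover is small enough under the first and the third condition of the theorem. -/
theorem GreedyRun.ncard_le {G : SimpleGraph V} {S : Set (Sym2 V)} (h : GreedyRun G S)
    (hG : IsIrreducible G) (hc : (triangles G).ncard ≤ 3 * packingNumber G ∨
      2 * (triangles G).ncard ≤ G.edgeSet.ncard) : S.ncard ≤ 2 * packingNumber G := by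
  have h1 := h.three_mul_ncard_le
  have h2 := h.ncard_add_le
  have h3 : G.edgeSet.ncard ≤ (triangleEdges G).ncard := Set.ncard_le_ncard hG
  omega

end Greedy

/-! ### The greedy cut -/

section Cut

open Finset

theorem sum_ind_eq_ncard {V : Type*} {n : ℕ} (f : V ≃ Fin n) (Q : ℕ → Prop) :
    ∑ j ∈ range n, ind (Q j) = {u : V | Q (f u)}.ncard := by
  classical
  have : Fintype V := Fintype.ofEquiv _ f.symm
  rw [Finset.sum_range fun j => ind (Q j), Set.ncard_eq_toFinset_card']
  simp only [ind, Set.toFinset_ofPred, Finset.card_filter]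
  exact (Equiv.sum_comp f fun i : Fin n => if Q i then 1 else 0).symm

/-- A set of edges without loops is counted by the vertex of larger rank. -/
theorem ncard_eq_sum {V : Type*} {n : ℕ} (f : V ≃ Fin n) {S : Set (Sym2 V)}
    (hS : ∀ v, s(v, v) ∉ S) :
    S.ncard = ∑ i ∈ range n, ∑ j ∈ range n,
      ind (j < i ∧ ∃ u v, (f u : ℕ) = i ∧ (f v : ℕ) = j ∧ s(u, v) ∈ S) := by
  classical
  have : Fintype V := Fintype.ofEquiv _ f.symm
  have h1 : ∀ u v : V, (∃ u' v', (f u' : ℕ) = f u ∧ (f v' : ℕ) = f v ∧ s(u', v') ∈ S) ↔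
      s(u, v) ∈ S := by
    intro u v
    constructor
    · rintro ⟨u', v', hu, hv, h⟩
      rwa [f.injective (Fin.ext hu), f.injective (Fin.ext hv)] at h
    · exact fun h => ⟨u, v, rfl, rfl, h⟩
  simp only [sum_ind_eq_ncard f]
  rw [Finset.sum_range, ← Equiv.sum_comp f]
  simp only [h1, Set.ncard_eq_toFinset_card']
  rw [← Finset.card_sigma]
  symm
  refine Finset.card_bij (fun p _ => s(p.1, p.2)) ?_ ?_ ?_
  · rintro ⟨u, v⟩ h
    simpa using (by simpa using h : f v < f u ∧ s(u, v) ∈ S).2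
  · rintro ⟨u, v⟩ h ⟨u', v'⟩ h' he
    have k : f v < f u ∧ s(u, v) ∈ S := by simpa using h
    have k' : f v' < f u' ∧ s(u', v') ∈ S := by simpa using h'
    rcases Sym2.eq_iff.1 he with ⟨h1, h2⟩ | ⟨h1, h2⟩
    · dsimp only at h1 h2
      subst h1 h2
      rfl
    · dsimp only at h1 h2
      subst h1 h2
      exact absurd (k.1.trans k'.1) (lt_irrefl _)
  · intro e he
    induction e using Sym2.ind with
    | _ u v =>
      have he' : s(u, v) ∈ S := by simpa using he
      rcases lt_trichotomy (f u) (f v) with h | h | h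
      · exact ⟨⟨v, u⟩, by simpa [Sym2.eq_swap (a := v)] using ⟨h, he'⟩, Sym2.eq_swap⟩
      · rw [f.injective h] at he'
        exact absurd he' (hS v)
      · exact ⟨⟨u, v⟩, by simpa using ⟨h, he'⟩, rfl⟩

/-- The edges with both ends on the same side, where the side of `v` is whether `c v` holds. -/
def monoEdges {V : Type*} (G : SimpleGraph V) (c : V → Prop) : Set (Sym2 V) :=
  {e | ∃ u v, e = s(u, v) ∧ G.Adj u v ∧ (c u ↔ c v)}

theorem mem_monoEdges {V : Type*} {G : SimpleGraph V} {c : V → Prop} {u v : V} :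
    s(u, v) ∈ monoEdges G c ↔ G.Adj u v ∧ (c u ↔ c v) := by
  constructor
  · rintro ⟨x, y, h, h1, h2⟩
    rcases Sym2.eq_iff.1 h with ⟨rfl, rfl⟩ | ⟨rfl, rfl⟩
    · exact ⟨h1, h2⟩
    · exact ⟨h1.symm, h2.symm⟩
  · exact fun h => ⟨u, v, rfl, h.1, h.2⟩

/-- Two of the three vertices of a triangle lie on the same side. -/
theorem isTriangleCover_monoEdges {V : Type*} (G : SimpleGraph V) (c : V → Prop) :
    IsTriangleCover G (monoEdges G c) := by
  refine ⟨?_, ?_⟩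
  · rintro e ⟨u, v, rfl, h, -⟩
    exact h
  · rintro T ⟨x, y, z, h1, h2, h3, rfl⟩
    by_cases k1 : c x ↔ c y
    · exact ⟨s(x, y), mem_monoEdges.2 ⟨h1, k1⟩, by simp⟩
    by_cases k2 : c y ↔ c z
    · exact ⟨s(y, z), mem_monoEdges.2 ⟨h2, k2⟩, by simp⟩
    · exact ⟨s(x, z), mem_monoEdges.2 ⟨h3, by tauto⟩, by simp⟩

/-- The side of vertex `i`, given the sides `σ` of the smaller vertices: the one on which `i` has
fewer smaller neighbours. -/
noncomputable def cutSide (n : ℕ) (B : ℕ → ℕ → Prop) (σ : ℕ → ℕ) (i : ℕ) : ℕ :=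
  ind (∑ j ∈ range n, ind (j < i ∧ B i j ∧ ¬σ j = 0) <
    ∑ j ∈ range n, ind (j < i ∧ B i j ∧ σ j = 0))

/-- The sides of the first `k` vertices. -/
noncomputable def cutSides (n : ℕ) (B : ℕ → ℕ → Prop) (k : ℕ) : ℕ → ℕ :=
  Nat.rec (motive := fun _ => ℕ → ℕ) (fun _ => 0)
    (fun i σ => Function.update σ i (cutSide n B σ i)) k

theorem cutSide_congr {n : ℕ} {B : ℕ → ℕ → Prop} {σ τ : ℕ → ℕ} {i : ℕ}
    (h : ∀ j < i, σ j = τ j) : cutSide n B σ i = cutSide n B τ i := by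
  have h1 : ∀ j, (j < i ∧ B i j ∧ ¬σ j = 0) = (j < i ∧ B i j ∧ ¬τ j = 0) := fun j =>
    propext (and_congr_right fun hj => by rw [h j hj])
  have h2 : ∀ j, (j < i ∧ B i j ∧ σ j = 0) = (j < i ∧ B i j ∧ τ j = 0) := fun j =>
    propext (and_congr_right fun hj => by rw [h j hj])
  simp only [cutSide, h1, h2]

theorem cutSides_of_le {n : ℕ} {B : ℕ → ℕ → Prop} {k k' j : ℕ} (h : k ≤ k') (hj : j < k) :
    cutSides n B k' j = cutSides n B k j := by
  induction k', h using Nat.le_induction with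
  | base => rfl
  | succ k' hk ih =>
    rw [← ih]
    exact Function.update_of_ne (by omega) _ _

theorem cutSides_eq {n : ℕ} {B : ℕ → ℕ → Prop} {k i : ℕ} (hi : i < k) :
    cutSides n B k i = cutSide n B (cutSides n B k) i := by
  rw [cutSides_of_le (k := i + 1) hi (Nat.lt_succ_self i)]
  have : cutSides n B (i + 1) i = cutSide n B (cutSides n B i) i := Function.update_self _ _ _
  rw [this]
  exact cutSide_congr fun j hj => (cutSides_of_le hi.le hj).symm

/-- At most half of the edges have both ends on the same side of the greedy cut. -/
theorem two_mul_ncard_monoEdges_le {V : Type*} {n : ℕ} (f : V ≃ Fin n) (G : SimpleGraph V)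
    (B : ℕ → ℕ → Prop) (hB : ∀ u v, B (f u) (f v) ↔ G.Adj u v) :
    2 * (monoEdges G fun v => cutSides n B n (f v) = 0).ncard ≤ G.edgeSet.ncard := by
  set σ := cutSides n B n with hσ
  rw [ncard_eq_sum f (S := G.edgeSet) (by simp),
    ncard_eq_sum f (fun v h => (mem_monoEdges.1 h).1.ne rfl), Finset.mul_sum]
  refine Finset.sum_le_sum fun i hi => ?_
  rw [Finset.mem_range] at hi
  have key : ∀ j ∈ range n, ∀ (Q : ℕ → ℕ → Prop),
      ((∃ u v, (f u : ℕ) = i ∧ (f v : ℕ) = j ∧ (G.Adj u v ∧ Q (f u) (f v))) ↔ B i j ∧ Q i j) := by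
    intro j hj Q
    rw [Finset.mem_range] at hj
    constructor
    · rintro ⟨u, v, rfl, rfl, h⟩
      exact ⟨(hB u v).2 h.1, h.2⟩
    · intro h
      refine ⟨f.symm ⟨i, hi⟩, f.symm ⟨j, hj⟩, by simp, by simp, (hB _ _).1 (by simpa using h.1), ?_⟩
      simpa using h.2
  have e1 : ∀ j ∈ range n, ind (j < i ∧ ∃ u v, (f u : ℕ) = i ∧ (f v : ℕ) = j ∧
      s(u, v) ∈ monoEdges G fun v => σ (f v) = 0) = ind (j < i ∧ B i j ∧ (σ i = 0 ↔ σ j = 0)) := by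
    intro j hj
    simp only [mem_monoEdges]
    rw [key j hj fun a b => (σ a = 0 ↔ σ b = 0)]
  have e2 : ∀ j ∈ range n, ind (j < i ∧ ∃ u v, (f u : ℕ) = i ∧ (f v : ℕ) = j ∧
      s(u, v) ∈ G.edgeSet) = ind (j < i ∧ B i j ∧ ¬σ j = 0) + ind (j < i ∧ B i j ∧ σ j = 0) := by
    intro j hj
    have := key j hj fun _ _ => True
    simp only [and_true] at this
    simp only [SimpleGraph.mem_edgeSet]
    rw [this]
    unfold ind
    by_cases h1 : j < i <;> by_cases h2 : B i j <;> by_cases h3 : σ j = 0 <;> simp [h1, h2, h3]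
  rw [Finset.sum_congr rfl e1, Finset.sum_congr rfl e2, Finset.sum_add_distrib]
  have hs : σ i = cutSide n B σ i := cutSides_eq hi
  by_cases h : ∑ j ∈ range n, ind (j < i ∧ B i j ∧ ¬σ j = 0) <
      ∑ j ∈ range n, ind (j < i ∧ B i j ∧ σ j = 0)
  · have h1 : σ i ≠ 0 := by rw [hs, cutSide, ind_pos h]; exact one_ne_zero
    simp only [h1, false_iff]
    omega
  · have h1 : σ i = 0 := by rw [hs, cutSide, ind_neg h]
    simp only [h1, true_iff]
    omega

theorem exists_cover_of_four_mul {V : Type*} [Finite V] {G : SimpleGraph V}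
    (h : G.edgeSet.ncard ≤ 4 * packingNumber G) :
    ∃ S, IsTriangleCover G S ∧ S.ncard ≤ 2 * packingNumber G := by
  obtain ⟨n, ⟨f⟩⟩ := Finite.exists_equiv_fin V
  obtain ⟨c, hc⟩ : ∃ c, 2 * (monoEdges G c).ncard ≤ G.edgeSet.ncard :=
    ⟨_, two_mul_ncard_monoEdges_le f G
      (fun i j => ∃ u v, (f u : ℕ) = i ∧ (f v : ℕ) = j ∧ G.Adj u v)
      (fun u v => ⟨fun ⟨u', v', hu, hv, h⟩ => by
        rwa [f.injective (Fin.ext hu), f.injective (Fin.ext hv)] at h,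
        fun h => ⟨u, v, rfl, rfl, h⟩⟩)⟩
  exact ⟨_, isTriangleCover_monoEdges G c, by omega⟩

theorem coveringNumber_le_two_mul {V : Type*} [Finite V] {G : SimpleGraph V}
    (hG : IsIrreducible G) (h : (triangles G).ncard ≤ 3 * packingNumber G ∨
      G.edgeSet.ncard ≤ 4 * packingNumber G ∨ 2 * (triangles G).ncard ≤ G.edgeSet.ncard) :
    coveringNumber G ≤ 2 * packingNumber G := by
  obtain ⟨S, hS, hc⟩ : ∃ S, IsTriangleCover G S ∧ S.ncard ≤ 2 * packingNumber G := by
    rcases h with h | h | h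
    · obtain ⟨S, hS⟩ := exists_greedyRun G
      exact ⟨S, hS.isTriangleCover, hS.ncard_le hG (Or.inl h)⟩
    · exact exists_cover_of_four_mul h
    · obtain ⟨S, hS⟩ := exists_greedyRun G
      exact ⟨S, hS.isTriangleCover, hS.ncard_le hG (Or.inr h)⟩
  exact (Nat.sInf_le (s := {k | ∃ S, IsTriangleCover G S ∧ S.ncard = k}) ⟨S, hS, rfl⟩).trans hc

end Cut

/-! ### The algorithm on arrays -/

section Algorithm

variable {α : Type} [Context α]

theorem CompP.iff {Q R : ℕ → Mem → α → Prop} (hQ : CompP Q) (hR : CompP R) :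
    CompP fun n m a => (Q n m a ↔ R n m a) := by
  simpa only [iff_iff_and_or_not_and_not] using (hQ.and hR).or (hQ.not.and hR.not)

/-- Adjacency in the input graph (array `0`) without the edges that are marked in array `2` and
without the edge `xy`. With `x = y = n` no further edge is left out. -/
def AdjM (n : ℕ) (m : Mem) (x y i j : ℕ) : Prop :=
  ¬m 0 (i * n + j) = 0 ∧ m 2 (i * n + j) = 0 ∧ ¬(i = x ∧ j = y ∨ i = y ∧ j = x)

/-- `codeg` for a relation `R` on the numbers below `n`. -/
noncomputable def codegN (n : ℕ) (R : ℕ → ℕ → Prop) (i j : ℕ) : ℕ :=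
  ∑ k ∈ Finset.range n, ind (R i k ∧ R j k)

/-- `IsCenter` for a relation `R` on the numbers below `n`. -/
def CenterN (n : ℕ) (R : ℕ → ℕ → Prop) (i j : ℕ) : Prop :=
  ∃ k < n, R i k ∧ R j k ∧ codegN n R i k = 1 ∧ codegN n R j k = 1

/-- `HasLeaf` for a relation `R` on the numbers below `n`. -/
def LeafN (n : ℕ) (R : ℕ → ℕ → Prop) : Prop := ∃ i < n, ∃ j < n, R i j ∧ CenterN n R i j

open Classical in
/-- The priority of `ij` in the graph of the unmarked edges. -/
noncomputable def prioM (n : ℕ) (m : Mem) (i j : ℕ) : ℕ :=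
  if ¬AdjM n m n n i j then 0
  else if CenterN n (AdjM n m n n) i j then 4
  else if 3 ≤ codegN n (AdjM n m n n) i j then 3
  else if 2 ≤ codegN n (AdjM n m n n) i j then (if LeafN n (AdjM n m i j) then 2 else 1)
  else 0

/-- The pair `ij` has maximal priority. -/
def BestM (n : ℕ) (m : Mem) (i j : ℕ) : Prop :=
  ∀ i' < n, ∀ j' < n, prioM n m i' j' ≤ prioM n m i j

/-- Increase the marks of `ij` and `ji` by `p`. -/
def markM (n : ℕ) (m : Mem) (i j p : ℕ) : Mem :=
  let m' := m.set 2 (i * n + j) (m 2 (i * n + j) + p)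
  m'.set 2 (j * n + i) (m' 2 (j * n + i) + p)

/-- One step of the greedy rule: an edge of maximal priority is marked. -/
noncomputable def stepM (n : ℕ) (m : Mem) : Mem :=
  let i := lastIndex n fun i => ∃ j < n, BestM n m i j
  let j := lastIndex n fun j => BestM n m i j
  markM n m i j (prioM n m i j)

/-- Write the sides of the greedy cut to array `3`. -/
noncomputable def cutM (n : ℕ) (m : Mem) : Mem :=
  Nat.rec (motive := fun _ => Mem) m
    (fun i m' => m'.set 3 i (cutSide n (fun i j => ¬m' 0 (i * n + j) = 0) (m' 3) i)) n

/-- The edge `ij` has both ends on the same side. -/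
def MonoM (n : ℕ) (m : Mem) (i j : ℕ) : Prop :=
  ¬m 0 (i * n + j) = 0 ∧ (m 3 i = 0 ↔ m 3 j = 0)

/-- The number of edges `ij` with `Q i j`, for a symmetric relation `Q`. -/
noncomputable def countM (n : ℕ) (Q : ℕ → ℕ → Prop) : ℕ :=
  ∑ i ∈ Finset.range n, ∑ j ∈ Finset.range n, ind (j < i ∧ Q i j)

/-- The smaller one of the two covers. -/
def OutM (n : ℕ) (m : Mem) (i j : ℕ) : Prop :=
  countM n (fun i j => ¬m 2 (i * n + j) = 0) ≤ countM n (MonoM n m) ∧ ¬m 2 (i * n + j) = 0 ∨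
  ¬countM n (fun i j => ¬m 2 (i * n + j) = 0) ≤ countM n (MonoM n m) ∧ MonoM n m i j

/-- Write row `i` of the smaller cover to array `1`. -/
noncomputable def outRowM (n : ℕ) (m : Mem) (i : ℕ) : Mem :=
  Nat.rec (motive := fun _ => Mem) m (fun j m' => m'.set 1 (i * n + j) (ind (OutM n m' i j))) n

/-- Write the smaller cover to array `1`. -/
noncomputable def outM (n : ℕ) (m : Mem) : Mem :=
  Nat.rec (motive := fun _ => Mem) m (fun i m' => outRowM n m' i) n

open Tuza.Comp

variable {x y i j : ℕ → Mem → α → ℕ}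

theorem comp_cell (b : ℕ) (hi : Comp i) (hj : Comp j) :
    Comp fun n m a => m b (i n m a * n + j n m a) :=
  (hi.mul_size.add hj).read b

theorem comp_cell_eq_zero (b : ℕ) (hi : Comp i) (hj : Comp j) :
    CompP fun n m a => m b (i n m a * n + j n m a) = 0 :=
  CompP.eq (comp_cell b hi hj) (const 0)

theorem comp_adjM (hx : Comp x) (hy : Comp y) (hi : Comp i) (hj : Comp j) :
    CompP fun n m a => AdjM n m (x n m a) (y n m a) (i n m a) (j n m a) :=
  (comp_cell_eq_zero 0 hi hj).not.and ((comp_cell_eq_zero 2 hi hj).and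
    (((CompP.eq hi hx).and (CompP.eq hj hy)).or ((CompP.eq hi hy).and (CompP.eq hj hx))).not)

theorem comp_codegN (hx : Comp x) (hy : Comp y) (hi : Comp i) (hj : Comp j) :
    Comp fun n m a => codegN n (AdjM n m (x n m a) (y n m a)) (i n m a) (j n m a) :=
  sum ((comp_adjM hx.weaken hy.weaken hi.weaken var).and
    (comp_adjM hx.weaken hy.weaken hj.weaken var))

theorem comp_centerN (hx : Comp x) (hy : Comp y) (hi : Comp i) (hj : Comp j) :
    CompP fun n m a => CenterN n (AdjM n m (x n m a) (y n m a)) (i n m a) (j n m a) :=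
  CompP.ex ((comp_adjM hx.weaken hy.weaken hi.weaken var).and
    ((comp_adjM hx.weaken hy.weaken hj.weaken var).and
    ((CompP.eq (comp_codegN hx.weaken hy.weaken hi.weaken var) (const 1)).and
    (CompP.eq (comp_codegN hx.weaken hy.weaken hj.weaken var) (const 1)))))

theorem comp_leafN (hx : Comp x) (hy : Comp y) :
    CompP fun n m a => LeafN n (AdjM n m (x n m a) (y n m a)) :=
  CompP.ex (CompP.ex
    ((comp_adjM hx.weaken.weaken hy.weaken.weaken var.weaken var).and
    (comp_centerN hx.weaken.weaken hy.weaken.weaken var.weaken var)))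

open Classical in
theorem comp_prioM (hi : Comp i) (hj : Comp j) :
    Comp fun n m a => prioM n m (i n m a) (j n m a) :=
  Comp.ite (comp_adjM size size hi hj).not (const 0)
    (Comp.ite (comp_centerN size size hi hj) (const 4)
    (Comp.ite (CompP.le (const 3) (comp_codegN size size hi hj)) (const 3)
    (Comp.ite (CompP.le (const 2) (comp_codegN size size hi hj))
    (Comp.ite (comp_leafN hi hj) (const 2) (const 1)) (const 0))))

theorem comp_bestM (hi : Comp i) (hj : Comp j) :
    CompP fun n m a => BestM n m (i n m a) (j n m a) :=
  CompP.all (CompP.all (CompP.le (comp_prioM var.weaken var)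
    (comp_prioM hi.weaken.weaken hj.weaken.weaken)))

theorem exec_markM {p : ℕ → Mem → α → ℕ} (hi : Comp i) (hj : Comp j) (hp : Comp p) :
    Exec fun n m a => markM n m (i n m a) (j n m a) (p n m a) :=
  -- the indices are kept in local variables, since the first write may change them
  Exec.letVar (F := fun n m a i' => markM n m i' (j n m a) (p n m a)) hi <|
  Exec.letVar (F := fun n m a j' => markM n m a.2 j' (p n m a.1)) hj.weaken <|
  Exec.letVar (F := fun n m a p' => markM n m a.1.2 a.2 p') hp.weaken.weaken <|
  (Exec.write 2 (var.weaken.weaken.mul_size.add var.weaken)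
    ((comp_cell 2 var.weaken.weaken var.weaken).add var)).seq
  (Exec.write 2 (var.weaken.mul_size.add var.weaken.weaken)
    ((comp_cell 2 var.weaken var.weaken.weaken).add var))

theorem exec_stepM : Exec fun n m (_ : α) => stepM n m := by
  have hi : Comp fun n m (_ : α) => lastIndex n fun i => ∃ j < n, BestM n m i j :=
    Comp.lastIndex (CompP.ex (comp_bestM var.weaken var))
  have hj : Comp fun n m (_ : α) =>
      lastIndex n fun j => BestM n m (lastIndex n fun i => ∃ j < n, BestM n m i j) j :=
    Comp.lastIndex (comp_bestM hi.weaken var)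
  exact exec_markM hi hj (comp_prioM hi hj)

theorem exec_cutM : Exec fun n m (_ : α) => cutM n m := by
  have h : ∀ {Q : ℕ → Mem → (α × ℕ) × ℕ → Prop}, CompP Q → CompP fun n m (p : (α × ℕ) × ℕ) =>
      p.2 < p.1.2 ∧ ¬m 0 (p.1.2 * n + p.2) = 0 ∧ Q n m p := fun hQ =>
    (CompP.lt var var.weaken).and ((comp_cell_eq_zero 0 var.weaken var).not.and hQ)
  have hz : CompP fun n m (p : (α × ℕ) × ℕ) => m 3 p.2 = 0 := CompP.eq (var.read 3) (const 0)
  exact Exec.loop (Exec.write 3 var (CompP.lt (sum (h hz.not)) (sum (h hz))))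

theorem comp_monoM (hi : Comp i) (hj : Comp j) :
    CompP fun n m a => MonoM n m (i n m a) (j n m a) :=
  (comp_cell_eq_zero 0 hi hj).not.and
    (CompP.iff (CompP.eq (hi.read 3) (const 0)) (CompP.eq (hj.read 3) (const 0)))

theorem comp_countM {Q : ℕ → Mem → ℕ → ℕ → Prop}
    (hQ : CompP fun n m (p : (α × ℕ) × ℕ) => Q n m p.1.2 p.2) :
    Comp fun n m (_ : α) => countM n (Q n m) :=
  sum (sum ((CompP.lt var var.weaken).and hQ))

theorem comp_outM (hi : Comp i) (hj : Comp j) :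
    CompP fun n m a => OutM n m (i n m a) (j n m a) := by
  have hc : CompP fun n m (_ : α) =>
      countM n (fun i j => ¬m 2 (i * n + j) = 0) ≤ countM n (MonoM n m) :=
    CompP.le (comp_countM (comp_cell_eq_zero 2 var.weaken var).not)
      (comp_countM (comp_monoM var.weaken var))
  exact (hc.and (comp_cell_eq_zero 2 hi hj).not).or (hc.not.and (comp_monoM hi hj))

theorem exec_outM : Exec fun n m (_ : α) => outM n m := by
  have h : Exec fun n m (p : α × ℕ) => outRowM n m p.2 :=
    Exec.loop (Exec.write 1 (var.weaken.mul_size.add var) (comp_outM var.weaken var))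
  exact Exec.loop h

/-- The algorithm: `n * n` steps of the greedy rule (there are at most that many edges), the greedy
cut, and the output of the smaller cover. -/
noncomputable def tuzaM (n : ℕ) (m : Mem) : Mem := outM n (cutM n ((stepM n)^[n * n] m))

theorem exec_tuzaM : Exec fun n m (_ : α) => tuzaM n m := by
  have h : Exec fun n m (_ : α) => (stepM n)^[n * n] m := by
    simp only [Function.iterate_mul]
    exact Exec.iterate (F := fun n => (stepM n)^[n]) fun β _ =>
      Exec.iterate fun γ _ => exec_stepM
  exact (h.seq exec_cutM).seq exec_outM

end Algorithm

/-! ### Correctness of the algorithm -/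

section Correctness

theorem Mem.set_ne (m : Mem) {b b' : ℕ} (i v : ℕ) (h : b' ≠ b) : m.set b i v b' = m b' :=
  Function.update_of_ne h _ _

theorem Mem.set_self (m : Mem) (b i v k : ℕ) :
    m.set b i v b k = if k = i then v else m b k := by
  simp [Mem.set, Function.update_apply]

theorem cell_inj {n i j i' j' : ℕ} (hj : j < n) (hj' : j' < n) (h : i * n + j = i' * n + j') :
    i = i' ∧ j = j' := by
  have h1 : (i * n + j) / n = i := by
    rw [mul_comm, Nat.mul_add_div (by omega), Nat.div_eq_of_lt hj, add_zero]
  have h2 : (i' * n + j') / n = i' := by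
    rw [mul_comm, Nat.mul_add_div (by omega), Nat.div_eq_of_lt hj', add_zero]
  have hi : i = i' := by rw [← h1, h, h2]
  subst hi
  exact ⟨rfl, by omega⟩

theorem edgeMatrix_cell {n : ℕ} (S : Set (Sym2 (Fin n))) (i j : Fin n) :
    edgeMatrix n S (i * n + j) = ind (s(i, j) ∈ S) := by
  unfold edgeMatrix ind
  congr 1
  refine propext ⟨?_, fun h => ⟨i, j, rfl, h⟩⟩
  rintro ⟨i', j', h, hS⟩
  obtain ⟨h1, h2⟩ := cell_inj j.2 j'.2 h
  rwa [Fin.ext h1, Fin.ext h2]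

variable {n : ℕ}

/-- The relation `R` on numbers is the adjacency of `H`. -/
def Models (R : ℕ → ℕ → Prop) (H : SimpleGraph (Fin n)) : Prop :=
  ∀ i j : Fin n, R i j ↔ H.Adj i j

theorem Models.codeg_eq {R : ℕ → ℕ → Prop} {H : SimpleGraph (Fin n)} (h : Models R H)
    (i j : Fin n) : codegN n R i j = codeg H i j := by
  unfold codegN codeg
  rw [sum_ind_eq_ncard (Equiv.refl (Fin n)) fun k => R i k ∧ R j k]
  simp only [Equiv.refl_apply, h i _, h j _]

theorem Models.center_iff {R : ℕ → ℕ → Prop} {H : SimpleGraph (Fin n)} (h : Models R H)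
    (i j : Fin n) : CenterN n R i j ↔ IsCenter H i j := by
  constructor
  · rintro ⟨k, hk, h1, h2, h3, h4⟩
    lift k to Fin n using hk
    exact ⟨k, (h _ _).1 h1, (h _ _).1 h2, h.codeg_eq i k ▸ h3, h.codeg_eq j k ▸ h4⟩
  · rintro ⟨k, h1, h2, h3, h4⟩
    exact ⟨k, k.2, (h _ _).2 h1, (h _ _).2 h2, h.codeg_eq i k ▸ h3, h.codeg_eq j k ▸ h4⟩

theorem Models.leaf_iff {R : ℕ → ℕ → Prop} {H : SimpleGraph (Fin n)} (h : Models R H) :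
    LeafN n R ↔ HasLeaf H := by
  constructor
  · rintro ⟨i, hi, j, hj, h1, h2⟩
    lift i to Fin n using hi
    lift j to Fin n using hj
    exact ⟨i, j, (h _ _).1 h1, (h.center_iff i j).1 h2⟩
  · rintro ⟨i, j, h1, h2⟩
    exact ⟨i, i.2, j, j.2, (h _ _).2 h1, (h.center_iff i j).2 h2⟩

/-- Array `0` stores the graph `G`, and array `2` marks the edges in `S`. -/
structure Stores (m : Mem) (G : SimpleGraph (Fin n)) (S : Set (Sym2 (Fin n))) : Prop where
  graph : ∀ i j : Fin n, m 0 (i * n + j) = 0 ↔ ¬G.Adj i j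
  marks : ∀ i j : Fin n, m 2 (i * n + j) = 0 ↔ s(i, j) ∉ S

variable {m : Mem} {G : SimpleGraph (Fin n)} {S : Set (Sym2 (Fin n))}

theorem Stores.models (h : Stores m G S) : Models (AdjM n m n n) (G.deleteEdges S) := by
  intro i j
  have h1 := i.2
  have h2 := j.2
  rw [AdjM, h.graph, h.marks, SimpleGraph.deleteEdges_adj, not_not]
  constructor
  · exact fun k => ⟨k.1, k.2.1⟩
  · exact fun k => ⟨k.1, k.2, by omega⟩

theorem Stores.models_del (h : Stores m G S) (u v : Fin n) :
    Models (AdjM n m u v) (del (G.deleteEdges S) u v) := by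
  intro i j
  rw [AdjM, h.graph, h.marks, del_adj, SimpleGraph.deleteEdges_adj, not_not, and_assoc]
  simp only [Fin.ext_iff]

theorem Stores.prio_eq (h : Stores m G S) (i j : Fin n) :
    prioM n m i j = prio (G.deleteEdges S) i j := by
  unfold prioM prio
  rw [h.models.codeg_eq, propext (h.models i j), propext (h.models.center_iff i j),
    propext (h.models_del i j).leaf_iff]

theorem Stores.mark_zero (h : Stores m G S) (i j : ℕ) : Stores (markM n m i j 0) G S := by
  have : markM n m i j 0 = m := by
    simp [markM, Mem.set]
  rwa [this]

theorem Stores.mark (h : Stores m G S) (i j : Fin n) {p : ℕ} (hp : p ≠ 0) :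
    Stores (markM n m i j p) G (insert s(i, j) S) where
  graph := by
    intro a b
    rw [markM, Mem.set_ne _ _ _ (by decide), Mem.set_ne _ _ _ (by decide), h.graph]
  marks := by
    intro a b
    have h1 : (a : ℕ) * n + b = i * n + j ↔ a = i ∧ b = j :=
      ⟨fun k => by
        obtain ⟨k1, k2⟩ := cell_inj b.2 j.2 k
        exact ⟨Fin.ext k1, Fin.ext k2⟩, fun k => by rw [k.1, k.2]⟩
    have h2 : (a : ℕ) * n + b = j * n + i ↔ a = j ∧ b = i :=
      ⟨fun k => by
        obtain ⟨k1, k2⟩ := cell_inj b.2 i.2 k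
        exact ⟨Fin.ext k1, Fin.ext k2⟩, fun k => by rw [k.1, k.2]⟩
    have h3 := h.marks a b
    simp only [markM, Mem.set_self]
    rw [Set.mem_insert_iff, Sym2.eq_iff, not_or, ← h3, ← h1, ← h2]
    split_ifs <;> grind

/-- A step of the algorithm is a step of the greedy rule. -/
theorem Stores.step (h : Stores m G S) :
    ((∀ u v, prio (G.deleteEdges S) u v = 0) ∧ Stores (stepM n m) G S) ∨
    ∃ u v, prio (G.deleteEdges S) u v ≠ 0 ∧
      (∀ x y, prio (G.deleteEdges S) x y ≤ prio (G.deleteEdges S) u v) ∧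
      Stores (stepM n m) G (insert s(u, v) S) := by
  rcases Nat.eq_zero_or_pos n with rfl | hn
  · exact Or.inl ⟨fun u => u.elim0, ⟨fun i => i.elim0, fun i => i.elim0⟩⟩
  have : Nonempty (Fin n × Fin n) := ⟨(⟨0, hn⟩, ⟨0, hn⟩)⟩
  obtain ⟨⟨u₀, v₀⟩, hmax⟩ :=
    Finite.exists_max fun p : Fin n × Fin n => prio (G.deleteEdges S) p.1 p.2
  have hbest : BestM n m u₀ v₀ := by
    intro i hi j hj
    lift i to Fin n using hi
    lift j to Fin n using hj
    rw [h.prio_eq, h.prio_eq]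
    exact hmax (i, j)
  obtain ⟨hi, hi'⟩ := lastIndex_spec (n := n) (Q := fun i => ∃ j < n, BestM n m i j)
    ⟨u₀, u₀.2, v₀, v₀.2, hbest⟩
  obtain ⟨hj, hj'⟩ := lastIndex_spec hi'
  dsimp only [stepM]
  set i := lastIndex n fun i => ∃ j < n, BestM n m i j
  set j := lastIndex n fun j => BestM n m i j
  clear_value i j
  lift i to Fin n using hi
  lift j to Fin n using hj
  have hm : ∀ x y, prio (G.deleteEdges S) x y ≤ prio (G.deleteEdges S) i j := fun x y => by
    rw [← h.prio_eq, ← h.prio_eq]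
    exact hj' x x.2 y y.2
  rw [h.prio_eq]
  by_cases hp : prio (G.deleteEdges S) i j = 0
  · refine Or.inl ⟨fun u v => Nat.le_zero.1 (hp ▸ hm u v), ?_⟩
    rw [hp]
    exact h.mark_zero i j
  · exact Or.inr ⟨i, j, hp, hm, h.mark i j hp⟩

theorem Stores.iterate_of_prio (h : Stores m G S) (h0 : ∀ u v, prio (G.deleteEdges S) u v = 0)
    (N : ℕ) : Stores ((stepM n)^[N] m) G S := by
  induction N with
  | zero => exact h
  | succ N ih =>
    rw [Function.iterate_succ_apply']
    rcases ih.step with h1 | ⟨u, v, h1, -⟩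
    · exact h1.2
    · exact absurd (h0 u v) h1

theorem Stores.iterate (h : Stores m G S) {N : ℕ} (hN : (G.deleteEdges S).edgeSet.ncard ≤ N) :
    ∃ R, GreedyRun (G.deleteEdges S) R ∧ Stores ((stepM n)^[N] m) G (S ∪ R) := by
  by_cases h0 : ∀ u v, prio (G.deleteEdges S) u v = 0
  · exact ⟨∅, .nil h0, by rw [Set.union_empty]; exact h.iterate_of_prio h0 N⟩
  induction N generalizing m S with
  | zero =>
    have he : (G.deleteEdges S).edgeSet = ∅ := (Set.ncard_eq_zero).1 (Nat.le_zero.1 hN)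
    refine absurd (fun u v => ?_) h0
    by_contra hp
    have : s(u, v) ∈ (G.deleteEdges S).edgeSet := adj_of_prio hp
    rw [he] at this
    exact this
  | succ N ih =>
    rcases h.step with h1 | ⟨u, v, hp, hm, hs⟩
    · exact absurd h1.1 h0
    have hd : G.deleteEdges (insert s(u, v) S) = del (G.deleteEdges S) u v := by
      rw [del, SimpleGraph.deleteEdges_deleteEdges, Set.union_singleton]
    have hlt : (G.deleteEdges (insert s(u, v) S)).edgeSet.ncard <
        (G.deleteEdges S).edgeSet.ncard := by
      rw [hd]
      refine Set.ncard_lt_ncard ⟨SimpleGraph.edgeSet_mono (del_le _ u v), fun hsub => ?_⟩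
      have := hsub (show s(u, v) ∈ (G.deleteEdges S).edgeSet from adj_of_prio hp)
      rw [SimpleGraph.mem_edgeSet, SimpleGraph.deleteEdges_adj] at this
      exact this.2 rfl
    rw [Function.iterate_succ_apply]
    obtain ⟨R, hR, hS⟩ : ∃ R, GreedyRun (G.deleteEdges (insert s(u, v) S)) R ∧
        Stores ((stepM n)^[N] (stepM n m)) G (insert s(u, v) S ∪ R) := by
      by_cases h0' : ∀ x y, prio (G.deleteEdges (insert s(u, v) S)) x y = 0
      · exact ⟨∅, .nil h0', by rw [Set.union_empty]; exact hs.iterate_of_prio h0' N⟩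
      · exact ih hs (by omega) h0'
    rw [hd] at hR
    refine ⟨_, .cons hp hm hR, ?_⟩
    rwa [Set.union_insert, ← Set.insert_union]

theorem stepM_iterate_of_ne (m : Mem) {b : ℕ} (hb : b ≠ 2) (N : ℕ) :
    (stepM n)^[N] m b = m b := by
  induction N with
  | zero => rfl
  | succ N ih =>
    rw [Function.iterate_succ_apply', ← ih]
    simp only [stepM, markM, Mem.set_ne _ _ _ hb]

theorem cutM_eq (m : Mem) (h : m 3 = fun _ => 0) :
    cutM n m = Function.update m 3 (cutSides n (fun i j => ¬m 0 (i * n + j) = 0) n) := by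
  unfold cutM
  suffices ∀ k, Nat.rec (motive := fun _ => Mem) m
      (fun i m' => m'.set 3 i (cutSide n (fun i j => ¬m' 0 (i * n + j) = 0) (m' 3) i)) k =
      Function.update m 3 (cutSides n (fun i j => ¬m 0 (i * n + j) = 0) k) from this n
  intro k
  induction k with
  | zero => exact (Function.update_eq_self_iff.2 h.symm).symm
  | succ k ih =>
    simp only [ih]
    simp [Mem.set, cutSides]

theorem OutM_congr {m m' : Mem} (h : ∀ b ≠ 1, m' b = m b) (i j : ℕ) :
    OutM n m' i j = OutM n m i j := by
  unfold OutM MonoM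
  rw [h 0 (by decide), h 2 (by decide), h 3 (by decide)]

/-- Writing a row leaves the other arrays alone, keeps correct cells correct, and makes the cells of
the row correct. -/
theorem outRowM_spec (m m₀ : Mem) (h : ∀ b ≠ 1, m b = m₀ b) (i : ℕ) :
    (∀ b ≠ 1, outRowM n m i b = m₀ b) ∧
    (∀ i' j', j' < n → m 1 (i' * n + j') = ind (OutM n m₀ i' j') →
      outRowM n m i 1 (i' * n + j') = ind (OutM n m₀ i' j')) ∧
    ∀ j < n, outRowM n m i 1 (i * n + j) = ind (OutM n m₀ i j) := by
  unfold outRowM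
  suffices ∀ k ≤ n, ∀ m'', m'' = Nat.rec (motive := fun _ => Mem) m
      (fun j m' => m'.set 1 (i * n + j) (ind (OutM n m' i j))) k →
      (∀ b ≠ 1, m'' b = m₀ b) ∧
      (∀ i' j', j' < n → m 1 (i' * n + j') = ind (OutM n m₀ i' j') →
        m'' 1 (i' * n + j') = ind (OutM n m₀ i' j')) ∧
      ∀ j < k, m'' 1 (i * n + j) = ind (OutM n m₀ i j) from this n le_rfl _ rfl
  intro k
  induction k with
  | zero =>
    rintro - m'' rfl
    exact ⟨h, fun _ _ _ h' => h', fun j hj => absurd hj (by omega)⟩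
  | succ k ih =>
    rintro hk m'' rfl
    obtain ⟨h1, h2, h3⟩ := ih (by omega) _ rfl
    have key : ∀ (M : Mem) (a b : ℕ), (∀ b ≠ 1, M b = m₀ b) → b < n →
        (M 1 (a * n + b) = ind (OutM n m₀ a b) ∨ a = i ∧ b = k) →
        M.set 1 (i * n + k) (ind (OutM n M i k)) 1 (a * n + b) = ind (OutM n m₀ a b) := by
      intro M a b hM hb hor
      rw [Mem.set_self, OutM_congr hM]
      split_ifs with hc
      · obtain ⟨rfl, rfl⟩ := cell_inj hb (by omega) hc
        rfl
      · exact hor.resolve_right fun hab => hc (by rw [hab.1, hab.2])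
    refine ⟨fun b hb => ?_, fun i' j' hj' h' => ?_, fun j hj => ?_⟩
    · exact (Mem.set_ne _ _ _ hb).trans (h1 b hb)
    · exact key _ i' j' h1 hj' (Or.inl (h2 i' j' hj' h'))
    · refine key _ i j h1 (by omega) ?_
      rcases Nat.lt_succ_iff_lt_or_eq.1 hj with hj | rfl
      · exact Or.inl (h3 j hj)
      · exact Or.inr ⟨rfl, rfl⟩

theorem outM_spec (m : Mem) {i j : ℕ} (hi : i < n) (hj : j < n) :
    outM n m 1 (i * n + j) = ind (OutM n m i j) := by
  unfold outM
  suffices ∀ k, ∀ m'', m'' = Nat.rec (motive := fun _ => Mem) m (fun i m' => outRowM n m' i) k →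
      (∀ b ≠ 1, m'' b = m b) ∧
      ∀ i < k, ∀ j < n, m'' 1 (i * n + j) = ind (OutM n m i j) from
    (this n _ rfl).2 i hi j hj
  intro k
  induction k with
  | zero =>
    rintro m'' rfl
    exact ⟨fun _ _ => rfl, fun i hi => absurd hi (by omega)⟩
  | succ k ih =>
    rintro m'' rfl
    obtain ⟨h1, h2⟩ := ih _ rfl
    obtain ⟨k1, k2, k3⟩ := outRowM_spec (n := n) _ m h1 k
    refine ⟨k1, fun i hi j hj => ?_⟩
    rcases Nat.lt_succ_iff_lt_or_eq.1 hi with hi | rfl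
    · exact k2 i j hj (h2 i hi j hj)
    · exact k3 j hj

theorem ncard_eq_countM {S : Set (Sym2 (Fin n))} (hS : ∀ v, s(v, v) ∉ S) {Q : ℕ → ℕ → Prop}
    (hQ : ∀ i j : Fin n, Q i j ↔ s(i, j) ∈ S) : S.ncard = countM n Q := by
  rw [ncard_eq_sum (Equiv.refl _) hS, countM]
  refine Finset.sum_congr rfl fun i hi => Finset.sum_congr rfl fun j hj => ?_
  lift i to Fin n using Finset.mem_range.1 hi
  lift j to Fin n using Finset.mem_range.1 hj
  congr 2
  rw [hQ]
  refine propext ⟨?_, fun h => ⟨i, j, rfl, rfl, h⟩⟩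
  rintro ⟨u, v, hu, hv, h⟩
  rwa [← Fin.ext hu, ← Fin.ext hv]

theorem ncard_edgeSet_le (G : SimpleGraph (Fin n)) : G.edgeSet.ncard ≤ n * n := by
  rw [ncard_eq_sum (Equiv.refl _) (by simp)]
  calc _ ≤ ∑ i ∈ Finset.range n, ∑ j ∈ Finset.range n, 1 := by
        refine Finset.sum_le_sum fun i _ => Finset.sum_le_sum fun j _ => ?_
        unfold ind
        split_ifs <;> omega
    _ = n * n := by simp

/-- The output of the algorithm is the smaller one of the cover from a greedy run and the cover from
the greedy cut. -/
theorem tuzaM_spec (G : SimpleGraph (Fin n)) : ∃ R C : Set (Sym2 (Fin n)), GreedyRun G R ∧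
    IsTriangleCover G C ∧ 2 * C.ncard ≤ G.edgeSet.ncard ∧ ∃ S,
    (R.ncard ≤ C.ncard ∧ S = R ∨ ¬R.ncard ≤ C.ncard ∧ S = C) ∧
    ∀ k < n * n, tuzaM n (inputState G).arr 1 k = edgeMatrix n S k := by
  set m := (inputState G).arr with hm
  have hadj : ∀ i j : Fin n, m 0 (i * n + j) = 0 ↔ ¬G.Adj i j := by
    intro i j
    have : m 0 (i * n + j) = ind (s(i, j) ∈ G.edgeSet) := edgeMatrix_cell _ i j
    rw [this, ← not_iff_not, ← ne_eq, ind_ne_zero, not_not, SimpleGraph.mem_edgeSet]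
  have hst : Stores m G ∅ := ⟨hadj, fun i j => by simp [hm, inputState]⟩
  obtain ⟨R, hR, hS⟩ := hst.iterate (N := n * n) (ncard_edgeSet_le _)
  rw [SimpleGraph.deleteEdges_empty] at hR
  rw [Set.empty_union] at hS
  have h0 : (stepM n)^[n * n] m 0 = m 0 := stepM_iterate_of_ne m (by decide) _
  have h3 : (stepM n)^[n * n] m 3 = fun _ => 0 := stepM_iterate_of_ne m (by decide) _
  set m₁ := (stepM n)^[n * n] m with hm₁
  set B : ℕ → ℕ → Prop := fun i j => ¬m₁ 0 (i * n + j) = 0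
  have hB : ∀ u v : Fin n, B u v ↔ G.Adj u v := fun u v => by
    change ¬m₁ 0 _ = 0 ↔ _
    rw [h0, hadj, not_not]
  have hcut := cutM_eq (n := n) m₁ h3
  set m₂ := cutM n m₁ with hm₂
  set C := monoEdges G fun v => cutSides n B n v = 0
  have hmono : ∀ i j : Fin n, MonoM n m₂ i j ↔ s(i, j) ∈ C := by
    intro i j
    rw [mem_monoEdges, ← hB, MonoM, hcut]
    rfl
  have hmark : ∀ i j : Fin n, ¬m₂ 2 (i * n + j) = 0 ↔ s(i, j) ∈ R := by
    intro i j
    rw [hcut, Function.update_of_ne (by decide), hS.marks, not_not]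
  have hRc := ncard_eq_countM (S := R) (fun v hv => by simpa using hR.subset hv)
    (Q := fun i j => ¬m₂ 2 (i * n + j) = 0) hmark
  have hCc := ncard_eq_countM (S := C) (fun v hv => (mem_monoEdges.1 hv).1.ne rfl) hmono
  refine ⟨R, C, hR, isTriangleCover_monoEdges _ _,
    two_mul_ncard_monoEdges_le (Equiv.refl _) G B hB, if R.ncard ≤ C.ncard then R else C, ?_, ?_⟩
  · split_ifs with h
    · exact Or.inl ⟨h, rfl⟩
    · exact Or.inr ⟨h, rfl⟩
  · intro k hk
    have hn : 0 < n := Nat.pos_of_ne_zero (by rintro rfl; simp at hk)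
    have hi : k / n < n := Nat.div_lt_of_lt_mul hk
    have hj : k % n < n := Nat.mod_lt _ hn
    have hk' : k = k / n * n + k % n := (Nat.div_add_mod' k n).symm
    generalize k / n = i at *
    generalize k % n = j at *
    subst hk'
    change outM n m₂ 1 _ = _
    rw [outM_spec _ hi hj]
    lift i to Fin n using hi
    lift j to Fin n using hj
    rw [edgeMatrix_cell]
    congr 1
    unfold OutM
    rw [← hRc, ← hCc, hmono, hmark]
    split_ifs with h <;> simp [h]

end Correctness

end Tuza

theorem mainTheorem1 :
    (∃ (A : Tuza.Program) (p : Polynomial ℕ), ∀ (n : ℕ) (G : SimpleGraph (Fin n)),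
      Tuza.IsIrreducible G →
      ((Tuza.triangles G).ncard ≤ 3 * Tuza.packingNumber G ∨
        G.edgeSet.ncard ≤ 4 * Tuza.packingNumber G ∨
        2 * (Tuza.triangles G).ncard ≤ G.edgeSet.ncard) →
      ∃ (t : ℕ) (s : Tuza.State) (S : Set (Sym2 (Fin n))),
        Tuza.Runs A (Tuza.inputState G) t s ∧ t ≤ p.eval n ∧
        Tuza.HasOutput s S ∧ Tuza.IsTriangleCover G S ∧
        S.ncard ≤ 2 * Tuza.packingNumber G) ∧
    (∀ (V : Type*) [Finite V] (G : SimpleGraph V),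
      Tuza.IsIrreducible G →
      ((Tuza.triangles G).ncard ≤ 3 * Tuza.packingNumber G ∨
        G.edgeSet.ncard ≤ 4 * Tuza.packingNumber G ∨
        2 * (Tuza.triangles G).ncard ≤ G.edgeSet.ncard) →
      Tuza.coveringNumber G ≤ 2 * Tuza.packingNumber G) := by
  refine ⟨?_, fun V _ G hG h => Tuza.coveringNumber_le_two_mul hG h⟩
  obtain ⟨P, hP⟩ := Tuza.exec_tuzaM (α := Unit)
  -- register `0` holds the size, all other registers are free
  obtain ⟨A, hA⟩ := hP 1 (fun _ => 0) one_pos fun _ => one_pos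
  refine ⟨A, P, fun n G hG h => ?_⟩
  obtain ⟨t, s, hr, ht, -, hs⟩ := hA (Tuza.inputState G) () trivial
  obtain ⟨R, C, hR, hC, hCe, S, hS, hout⟩ := Tuza.tuzaM_spec G
  refine ⟨t, s, S, hr, ht, fun k hk => ?_, ?_, ?_⟩
  · rw [hs]
    exact hout k hk
  · rcases hS with ⟨-, rfl⟩ | ⟨-, rfl⟩
    · exact hR.isTriangleCover
    · exact hC
  · have hRC : S.ncard ≤ R.ncard ∧ S.ncard ≤ C.ncard := by
      rcases hS with ⟨hle, rfl⟩ | ⟨hle, rfl⟩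
      · exact ⟨le_rfl, hle⟩
      · exact ⟨(not_le.1 hle).le, le_rfl⟩
    rcases h with h | h | h
    · exact hRC.1.trans (hR.ncard_le hG (Or.inl h))
    · omega
    · exact hRC.1.trans (hR.ncard_le hG (Or.inr h))
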